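/- Let $\mathfrak{H}$ be a real separable Hilbert space and let $\mathbb{X}=\{\mathbb{X}(\varphi):\varphi\in\mathfrak{H}\}$ be an isonormal Gaussian process over $\mathfrak{H}$, i.e. a centered Gaussian family with $\mathbb{E}(\mathbb{X}(\varphi)\mathbb{X}(\psi))=\langle\varphi,\psi\rangle_{\mathfrak{H}}$, on a probability space $(\Omega,\mathcal{F},P)$ whose $\sigma$-algebra is generated (up to null sets) by $\mathbb{X}$. For a smooth cylindrical random variable $F=f(\mathbb{X}(\varphi_1),\dots,\mathbb{X}(\varphi_n))$, with $f:\mathbb{R}^n\to\mathbb{R}$ smooth and bounded together with all its partial derivatives, put $D^kF=\sum_{i_1,\dots,i_k}\partial_{i_1}\cdots\partial_{i_k}f(\mathbb{X}(\varphi_1),\dots,\mathbb{X}(\varphi_n))\,\varphi_{i_1}\otimes\cdots\otimes\varphi_{i_k}$; the Sobolev space $\mathbb{D}^{k,p}$ is the closure of these variables in the norm $\|F\|_{k,p}^p=\mathbb{E}|F|^p+\sum_{i=1}^k\mathbb{E}\|D^iF\|^p_{\mathfrak{H}^{\otimes i}}$, and $D$ denotes the closed extension $D:\mathbb{D}^{1,2}\to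 L^2(\Omega;\mathfrak{H})$. The divergence $\delta$ is the adjoint of $D$: $u\in L^2(\Omega;\mathfrak{H})$ belongs to $\mathrm{Dom}\,\delta$ if $|\mathbb{E}\langle DG,u\rangle_{\mathfrak{H}}|\le c_u\|G\|_{L^2(\Omega)}$ for all $G\in\mathbb{D}^{1,2}$ and some constant $c_u$, and then $\delta(u)\in L^2(\Omega)$ is determined by $\mathbb{E}(G\,\delta(u))=\mathbb{E}\langle DG,u\rangle_{\mathfrak{H}}$ for all $G\in\mathbb{D}^{1,2}$. Let $u\in\mathrm{Dom}\,\delta$ and suppose that $F=\delta(u)\in\mathbb{D}^{3,2}$ and $\mathbb{E}(F^2)=1$. Write $D_uF=\langle u,DF\rangle_{\mathfrak{H}}$ and $D_u^{i+1}F=\langle u,D(D_u^iF)\rangle_{\mathfrak{H}}$ for $i\ge1$, where it is assumed that $D_uF$ and $D_u^2F$ belong to the domain $\mathbb{D}^{1,2}$ of $D$, so that these expressions make sense. Let $Z$ be a standard normal random variable and $d_{\mathrm{TV}}(F,Z)=\sup_{B}|P(F\in B)-P(Z\in B)|$, the supremum being over all Borel sets $B\subset\mathbb{R}$. Then $F^3$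 is integrable and $$d_{\mathrm{TV}}(F,Z)\le(8+\sqrt{32\pi})\,\mathbb{E}\big(\|D(D_uF)\|_{\mathfrak{H}}^2\big)+\sqrt{2\pi}\,|\mathbb{E}(F^3)|+\sqrt{32\pi}\,\mathbb{E}\big(|D_u^2F|^2\big)+4\pi\,\mathbb{E}\big(|D_u^3F|\big).$$ -/

import Mathlib

open MeasureTheory ProbabilityTheory Filter Topology
open scoped ENNReal

namespace Malliavin

variable {Ω H : Type*} [MeasurableSpace Ω] [NormedAddCommGroup H] [InnerProductSpace ℝ H]

/-- `X` is an isonormal Gaussian process over `H` on the probability space `(Ω, P)`: a centered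
Gaussian family of random variables with covariance `E[X(φ) X(ψ)] = ⟨φ, ψ⟩`. -/
structure IsIsonormal (X : H → Ω → ℝ) (P : Measure Ω) : Prop where
  measurable : ∀ φ, Measurable (X φ)
  gaussian : IsGaussianProcess X P
  centered : ∀ φ, ∫ ω, X φ ω ∂P = 0
  covariance : ∀ φ ψ, ∫ ω, X φ ω * X ψ ω ∂P = inner ℝ φ ψ

/-- The σ-algebra of `Ω` is generated by `X`, up to `P`-null sets (so that both the σ-algebra
`σ(X)` itself and its completion are covered). -/
def Generates (X : H → Ω → ℝ) (P : Measure Ω) : Prop :=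
  ∀ A : Set Ω, MeasurableSet A →
    ∃ B : Set Ω, MeasurableSet[⨆ φ, (borel ℝ).comap (X φ)] B ∧ A =ᵐ[P] B

/-- The data `(f; φ₁, …, φₙ)` of a smooth cylindrical random variable
`f(X(φ₁), …, X(φₙ))`, where `f` is smooth and bounded together with all its derivatives. -/
structure Cylindrical (H : Type*) where
  n : ℕ
  φ : Fin n → H
  f : (Fin n → ℝ) → ℝ
  smooth : ContDiff ℝ ((⊤ : ℕ∞) : WithTop ℕ∞) f
  bounded : ∀ k : ℕ, ∃ C : ℝ, ∀ x, ‖iteratedFDeriv ℝ k f x‖ ≤ C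

namespace Cylindrical

/-- The random vector `(X(φ₁), …, X(φₙ))`. -/
def vec (S : Cylindrical H) (X : H → Ω → ℝ) (ω : Ω) : Fin S.n → ℝ := fun i => X (S.φ i) ω

/-- The random variable `f(X(φ₁), …, X(φₙ))`. -/
def val (S : Cylindrical H) (X : H → Ω → ℝ) (ω : Ω) : ℝ := S.f (S.vec X ω)

/-- The Malliavin derivative `∑ᵢ ∂ᵢf(X(φ₁), …, X(φₙ)) φᵢ`, an `H`-valued random variable. -/
noncomputable def deriv (S : Cylindrical H) (X : H → Ω → ℝ) (ω : Ω) : H :=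
  ∑ i, fderiv ℝ S.f (S.vec X ω) (Pi.single i 1) • S.φ i

/-- The `k`-th Malliavin derivative
`∑ ∂_{i₁}⋯∂_{iₖ} f(X(φ₁), …, X(φₙ)) φ_{i₁} ⊗ ⋯ ⊗ φ_{iₖ}`. A tensor `T ∈ H^{⊗k}` is viewed as the
`k`-linear form `(h₁, …, hₖ) ↦ ⟨T, h₁ ⊗ ⋯ ⊗ hₖ⟩`. -/
noncomputable def iterDeriv (S : Cylindrical H) (X : H → Ω → ℝ) (k : ℕ) (ω : Ω) :
    ContinuousMultilinearMap ℝ (fun _ : Fin k => H) ℝ :=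
  (iteratedFDeriv ℝ k S.f (S.vec X ω)).compContinuousLinearMap
    (fun _ => ContinuousLinearMap.pi fun i => innerSL ℝ (S.φ i))

end Cylindrical

/-- The squared norm in the Hilbert tensor power `H^{⊗k}`, i.e. the squared Hilbert–Schmidt norm
`∑ |T(e_{j₁}, …, e_{jₖ})|²` over an orthonormal basis, written as the supremum over the finite
orthonormal families. -/
noncomputable def hsNormSq {k : ℕ} (T : ContinuousMultilinearMap ℝ (fun _ : Fin k => H) ℝ) :
    ℝ≥0∞ :=
  ⨆ (s : Finset H) (_ : Orthonormal ℝ (fun x : s => (x : H))),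
    ∑ j : Fin k → s, ENNReal.ofReal ((T fun i => (j i : H)) ^ 2)

/-- `F` belongs to the Sobolev space `𝔻^{k,p}`, the closure of the smooth cylindrical random
variables in the norm `‖F‖_{k,p}^p = E|F|^p + ∑_{i=1}^k E‖D^i F‖^p_{H^{⊗i}}`: it is the
`L^p`-limit of a sequence of smooth cylindrical random variables that is Cauchy in that norm. -/
def MemSobolev (X : H → Ω → ℝ) (P : Measure Ω) (k : ℕ) (p : ℝ) (F : Ω → ℝ) : Prop :=
  MemLp F (ENNReal.ofReal p) P ∧ ∃ S : ℕ → Cylindrical H,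
    Tendsto (fun n => eLpNorm (fun ω => (S n).val X ω - F ω) (ENNReal.ofReal p) P)
      atTop (𝓝 0) ∧
    ∀ i ∈ Finset.Icc 1 k, Tendsto (fun q : ℕ × ℕ =>
      ∫⁻ ω, hsNormSq ((S q.1).iterDeriv X i ω - (S q.2).iterDeriv X i ω) ^ (p / 2) ∂P)
      atTop (𝓝 0)

/-- `(F, G)` is in the graph of the closed operator `D : 𝔻^{1,2} → L²(Ω; H)`: `F` is a limit in
`L²(Ω)` of smooth cylindrical random variables whose derivatives converge to `G` in `L²(Ω; H)`. -/
def HasDeriv (X : H → Ω → ℝ) (P : Measure Ω) (F : Ω → ℝ) (G : Ω → H) : Prop :=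
  MemLp F 2 P ∧ MemLp G 2 P ∧ ∃ S : ℕ → Cylindrical H,
    Tendsto (fun n => eLpNorm (fun ω => (S n).val X ω - F ω) 2 P) atTop (𝓝 0) ∧
    Tendsto (fun n => eLpNorm (fun ω => (S n).deriv X ω - G ω) 2 P) atTop (𝓝 0)

open Classical in
/-- The Malliavin derivative `DF` of `F ∈ 𝔻^{1,2}`, an `H`-valued random variable (a version of
it: `D` is closable, so `DF` is determined almost surely); it is `0` when `F ∉ 𝔻^{1,2}`. -/
noncomputable def D (X : H → Ω → ℝ) (P : Measure Ω) (F : Ω → ℝ) : Ω → H :=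
  if h : ∃ G, HasDeriv X P F G then h.choose else 0

/-- `D_u F = ⟨u, DF⟩`; the iterates `D_u^{i+1} F = ⟨u, D(D_u^i F)⟩` are the iterates of this map. -/
noncomputable def Du (X : H → Ω → ℝ) (P : Measure Ω) (u : Ω → H) (F : Ω → ℝ) : Ω → ℝ :=
  fun ω => inner ℝ (u ω) (D X P F ω)

/-- The domain of the divergence `δ`: those `u ∈ L²(Ω; H)` with
`|E⟨DG, u⟩| ≤ c_u ‖G‖_{L²}` for all `G ∈ 𝔻^{1,2}`. -/
def MemDomDelta (X : H → Ω → ℝ) (P : Measure Ω) (u : Ω → H) : Prop :=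
  MemLp u 2 P ∧ ∃ c : ℝ, ∀ (G : Ω → ℝ) (DG : Ω → H), HasDeriv X P G DG →
    |∫ ω, inner ℝ (DG ω) (u ω) ∂P| ≤ c * (eLpNorm G 2 P).toReal

/-- `F = δ(u)`: `F ∈ L²(Ω)` and `E[G F] = E⟨DG, u⟩` for all `G ∈ 𝔻^{1,2}`. -/
def IsDivergence (X : H → Ω → ℝ) (P : Measure Ω) (u : Ω → H) (F : Ω → ℝ) : Prop :=
  MemLp F 2 P ∧ ∀ (G : Ω → ℝ) (DG : Ω → H), HasDeriv X P G DG →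
    ∫ ω, G ω * F ω ∂P = ∫ ω, inner ℝ (DG ω) (u ω) ∂P

/-- The total variation distance `sup_B |μ(B) - ν(B)|` over the Borel sets `B` of `ℝ`. -/
noncomputable def dTV (μ ν : Measure ℝ) : ℝ :=
  ⨆ B : {B : Set ℝ // MeasurableSet B}, |μ.real B - ν.real B|

theorem Cylindrical.iterDeriv_one (S : Cylindrical H) (X : H → Ω → ℝ) (ω : Ω) (m : Fin 1 → H) :
    S.iterDeriv X 1 ω m = inner ℝ (S.deriv X ω) (m 0) := by
  have h : ∀ v : Fin S.n → ℝ, fderiv ℝ S.f (S.vec X ω) v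
      = ∑ i, v i * fderiv ℝ S.f (S.vec X ω) (Pi.single i 1) := by
    intro v
    conv_lhs => rw [pi_eq_sum_univ' v]
    simp [map_sum]
  simp only [iterDeriv, ContinuousMultilinearMap.compContinuousLinearMap_apply,
    iteratedFDeriv_one_apply, deriv, sum_inner, inner_smul_left]
  rw [h]
  refine Finset.sum_congr rfl fun i _ => ?_
  simp only [ContinuousLinearMap.coe_pi', innerSL_apply_apply, RCLike.conj_to_real]
  ring

theorem hsNormSq_one (T : ContinuousMultilinearMap ℝ (fun _ : Fin 1 => H) ℝ) (g : H)
    (hT : ∀ m, T m = inner ℝ g (m 0)) : hsNormSq T = ENNReal.ofReal (‖g‖ ^ 2) := by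
  classical
  apply le_antisymm
  · refine iSup₂_le fun s hs => ?_
    rw [← ENNReal.ofReal_sum_of_nonneg (fun _ _ => sq_nonneg _)]
    apply ENNReal.ofReal_le_ofReal
    rw [← (Equiv.funUnique (Fin 1) s).symm.sum_comp]
    have := hs.sum_inner_products_le (x := g) (s := Finset.univ)
    refine le_trans (le_of_eq ?_) this
    refine Finset.sum_congr rfl fun x _ => ?_
    rw [hT, Real.norm_eq_abs, sq_abs, real_inner_comm]
    rfl
  · by_cases hg : g = 0
    · simp [hg]
    have hn : ‖g‖ ≠ 0 := norm_ne_zero_iff.2 hg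
    have ho : Orthonormal ℝ (fun x : ({‖g‖⁻¹ • g} : Finset H) => (x : H)) := by
      constructor
      · rintro ⟨x, hx⟩
        rw [Finset.mem_singleton] at hx
        simp [hx, norm_smul, hn]
      · rintro ⟨x, hx⟩ ⟨y, hy⟩ hxy
        rw [Finset.mem_singleton] at hx hy
        exact absurd (Subtype.ext (hx.trans hy.symm)) hxy
    refine le_trans ?_ (le_iSup₂ (f := fun (s : Finset H) (_ : Orthonormal ℝ (fun x : s => (x : H))) =>
      ∑ j : Fin 1 → s, ENNReal.ofReal ((T fun i => (j i : H)) ^ 2)) {‖g‖⁻¹ • g} ho)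
    have key := Finset.single_le_sum (s := Finset.univ)
      (f := fun j : Fin 1 → ({‖g‖⁻¹ • g} : Finset H) =>
        ENNReal.ofReal ((T fun i => (j i : H)) ^ 2)) (fun _ _ => zero_le)
      (Finset.mem_univ (fun _ => ⟨‖g‖⁻¹ • g, Finset.mem_singleton_self _⟩))
    refine le_trans (le_of_eq ?_) key
    simp only [hT, inner_smul_right, real_inner_self_eq_norm_sq]
    congr 2
    field_simp

theorem Cylindrical.memLp_deriv (S : Cylindrical H) {X : H → Ω → ℝ} {P : Measure Ω}
    [IsFiniteMeasure P] (hX : ∀ φ, Measurable (X φ)) : MemLp (S.deriv X) 2 P := by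
  obtain ⟨C, hC⟩ := S.bounded 1
  have hd : Continuous (fderiv ℝ S.f) := S.smooth.continuous_fderiv (by simp)
  refine memLp_finsetSum (f := fun i ω => fderiv ℝ S.f (S.vec X ω) (Pi.single i 1) • S.φ i)
    Finset.univ fun i _ => ?_
  refine MemLp.of_bound (C := C * ‖S.φ i‖) ?_ (ae_of_all _ fun ω => ?_)
  · have hv : Measurable (S.vec X) := measurable_pi_lambda _ fun i => hX _
    exact ((((hd.clm_apply continuous_const).measurable).comp hv).stronglyMeasurable.smul_const
      _).aestronglyMeasurable
  · rw [norm_smul]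
    gcongr
    refine (ContinuousLinearMap.le_opNorm _ _).trans ?_
    rw [← norm_iteratedFDeriv_one, Pi.norm_single, norm_one, mul_one]
    exact hC _

/-- The two descriptions of `𝔻^{1,2}` agree: every `F ∈ 𝔻^{1,2}` is in the domain of `D`. -/
theorem memSobolev_one_two_iff [CompleteSpace H] {X : H → Ω → ℝ} {P : Measure Ω}
    [IsFiniteMeasure P] (hX : ∀ φ, Measurable (X φ)) {F : Ω → ℝ} :
    MemSobolev X P 1 2 F ↔ ∃ G, HasDeriv X P F G := by
  have e2 : ENNReal.ofReal 2 = 2 := by simp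
  have hE : ∀ S : ℕ → Cylindrical H, ∀ q : ℕ × ℕ,
      ∫⁻ ω, hsNormSq ((S q.1).iterDeriv X 1 ω - (S q.2).iterDeriv X 1 ω) ^ ((2 : ℝ) / 2) ∂P
        = eLpNorm ((S q.1).deriv X - (S q.2).deriv X) 2 P ^ 2 := by
    intro S q
    rw [eLpNorm_eq_lintegral_rpow_enorm_toReal (by simp) (by simp), ← ENNReal.rpow_natCast,
      ← ENNReal.rpow_mul]
    simp only [ENNReal.toReal_ofNat, Nat.cast_ofNat, one_div, ne_eq, OfNat.ofNat_ne_zero,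
      not_false_eq_true, inv_mul_cancel₀, ENNReal.rpow_one, div_self]
    refine lintegral_congr fun ω => ?_
    rw [hsNormSq_one _ ((S q.1).deriv X ω - (S q.2).deriv X ω) (fun m => by
      simp [Cylindrical.iterDeriv_one, inner_sub_left]), Pi.sub_apply,
      ENNReal.ofReal_pow (norm_nonneg _), ofReal_norm]
    norm_cast
  have hsq : ∀ S : ℕ → Cylindrical H,
      (∀ i ∈ Finset.Icc 1 1, Tendsto (fun q : ℕ × ℕ =>
        ∫⁻ ω, hsNormSq ((S q.1).iterDeriv X i ω - (S q.2).iterDeriv X i ω) ^ ((2 : ℝ) / 2) ∂P)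
        atTop (𝓝 0)) ↔
      Tendsto (fun q : ℕ × ℕ => eLpNorm ((S q.1).deriv X - (S q.2).deriv X) 2 P)
        atTop (𝓝 0) := by
    intro S
    simp only [Finset.Icc_self, Finset.mem_singleton, forall_eq, hE]
    constructor
    · intro h
      have := (ENNReal.continuous_rpow_const (y := (1 / 2 : ℝ))).tendsto 0 |>.comp h
      rw [ENNReal.zero_rpow_of_pos (by norm_num)] at this
      refine this.congr fun q => ?_
      rw [Function.comp_apply, ← ENNReal.rpow_natCast, ← ENNReal.rpow_mul]
      norm_num
    · intro h
      have := (ENNReal.continuous_pow 2).tendsto 0 |>.comp h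
      rwa [zero_pow two_ne_zero] at this
  simp only [MemSobolev, hsq, e2]
  constructor
  · rintro ⟨hF, S, h0, h1⟩
    have hm := fun n => (S n).memLp_deriv (P := P) hX
    have hc : CauchySeq fun n => (hm n).toLp ((S n).deriv X) := by
      rw [Lp.cauchySeq_Lp_iff_cauchySeq_eLpNorm]
      refine h1.congr fun q => eLpNorm_congr_ae ?_
      exact ((hm q.1).coeFn_toLp.sub (hm q.2).coeFn_toLp).symm
    obtain ⟨G, hG⟩ := cauchySeq_tendsto_of_complete hc
    refine ⟨G, hF, Lp.memLp G, S, h0, ?_⟩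
    rw [Lp.tendsto_Lp_iff_tendsto_eLpNorm'] at hG
    refine hG.congr fun n => eLpNorm_congr_ae ?_
    exact (hm n).coeFn_toLp.sub (EventuallyEq.refl _ _)
  · rintro ⟨G, hF, hG, S, h0, h1⟩
    refine ⟨hF, S, h0, ?_⟩
    have hm := fun n => (S n).memLp_deriv (P := P) hX
    have hc := ((Lp.tendsto_Lp_iff_tendsto_eLpNorm'' _ hm G hG).2 h1).cauchySeq
    rw [Lp.cauchySeq_Lp_iff_cauchySeq_eLpNorm] at hc
    refine hc.congr fun q => eLpNorm_congr_ae ?_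
    exact (hm q.1).coeFn_toLp.sub (hm q.2).coeFn_toLp

end Malliavin

/-!
The proof is Stein's method with three nested Stein equations, combined with integration by parts
against the divergence `F = δ(u)`. Write `d = D_u F`, `e = D_u² F` and let `Z` be standard normal.

*Integration by parts.* The duality between `D` and `δ` and the chain rule `HasDeriv.comp₂` give
`E[F φ(F) M] = E[φ'(F) M d] + E[φ(F) D_u M]` for bounded smooth `φ` and `M ∈ 𝔻^{1,2}`
(`IsDivergence.integral_comp_mul_mul`). The factor `M` is unbounded, so it is first replaced by the
smooth truncation `N sin(M / N)`. Taking `M = F` shows that `F³` is integrable with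
`E F³ = 2 E[F d]`, and duality gives `E[F d] = E e`, hence `E e = E F³ / 2`. Likewise
`E d = E F² = 1`.

*Stein's equations.* For a bounded smooth `h`, the solution `φ` of `φ'(x) = x φ(x) + h(x) - E h(Z)`
is smooth, and if `|h - E h(Z)| ≤ c` then `|φ| ≤ c √(π/2)` and `|φ'| ≤ 2c`
(`exists_stein_solution`). Integration by parts turns this equation into
`E[(h(F) - E h(Z)) M] = -E[φ'(F) M (d - 1)] - E[φ(F) D_u M]` (`IsDivergence.integral_stein_mul`).
Let `f` solve the equation for a test function `h` with values in `[0, 1]`, let `φ` solve it for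
`f'`, and `ψ` for `φ`. Then
`E h(F) - E h(Z) = E[f'(F) (1 - d)] = E[φ'(F) (d - 1)²] + E[φ(F) e]` and
`E[φ(F) e] = E[φ(Z)] E e - E[ψ'(F) e (d - 1)] - E[ψ(F) D_u e]`,
and the bounds on `φ'`, `φ`, `ψ'`, `ψ` give the constants of the theorem, with the variance
`E[(d - 1)²]` in the place of `E‖D d‖²` (`IsDivergence.abs_integral_sub_le`).

*The Poincaré inequality.* `Var d ≤ E‖D d‖²` is `HasDeriv.poincare`. In dimension one it follows
from Stein's equation as well: if `g` is centered and `φ' = x φ + g`, then `E g² = -E[φ g']` and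
`E φ² ≤ E g²`. Tensorization gives the standard Gaussian law on `ℝⁿ`, an orthonormal basis of the
span of `φ₁, …, φₙ` gives cylindrical random variables, and a limit gives all of `𝔻^{1,2}`.

*Test functions.* It is enough to consider smooth `h` with values in `[0, 1]`, by regularity of
the measures and a smooth Urysohn lemma (`dTV_le_of_forall_contDiff`). With smooth `h` every Stein
solution is smooth, so that the chain rule is only ever needed for smooth functions.
-/

set_option linter.unusedSectionVars false

namespace Malliavin

/-! ### Stein's equation for the standard normal law -/

/-- The unnormalised standard Gaussian density. -/
noncomputable def gaussWeight (x : ℝ) : ℝ := Real.exp (-(1 / 2) * x ^ 2)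

theorem gaussWeight_pos (x : ℝ) : 0 < gaussWeight x := Real.exp_pos _

theorem gaussWeight_neg (x : ℝ) : gaussWeight (-x) = gaussWeight x := by simp [gaussWeight]

theorem integrable_gaussWeight : Integrable gaussWeight :=
  integrable_exp_neg_mul_sq (by norm_num)

theorem hasDerivAt_gaussWeight (x : ℝ) : HasDerivAt gaussWeight (-x * gaussWeight x) x := by
  have h := (((hasDerivAt_id x).pow 2).const_mul (-(1 / 2) : ℝ)).exp
  refine h.congr_deriv ?_
  simp [gaussWeight]
  ring

theorem contDiff_gaussWeight {n : WithTop ℕ∞} : ContDiff ℝ n gaussWeight := by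
  unfold gaussWeight
  fun_prop

theorem integral_gaussianReal_eq (f : ℝ → ℝ) :
    ∫ x, f x ∂gaussianReal 0 1 = (√(2 * Real.pi))⁻¹ * ∫ x, f x * gaussWeight x := by
  rw [integral_gaussianReal_eq_integral_smul one_ne_zero, ← integral_const_mul]
  refine integral_congr_ae (ae_of_all _ fun x => ?_)
  simp only [gaussianPDFReal, gaussWeight, NNReal.coe_one, mul_one, sub_zero, smul_eq_mul]
  rw [show -x ^ 2 / 2 = -(1 / 2) * x ^ 2 by ring]
  ring

theorem integrable_gaussianReal_iff (f : ℝ → ℝ) :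
    Integrable f (gaussianReal 0 1) ↔ Integrable fun x => f x * gaussWeight x := by
  rw [gaussianReal_of_var_ne_zero _ one_ne_zero,
    integrable_withDensity_iff_integrable_smul' (measurable_gaussianPDF _ _)
      (ae_of_all _ fun _ => gaussianPDF_lt_top)]
  have h : (fun x => (gaussianPDF 0 1 x).toReal • f x)
      = fun x => (√(2 * Real.pi))⁻¹ * (f x * gaussWeight x) := by
    funext x
    simp only [toReal_gaussianPDF, gaussianPDFReal, gaussWeight, NNReal.coe_one, mul_one,
      sub_zero, smul_eq_mul]
    rw [show -x ^ 2 / 2 = -(1 / 2) * x ^ 2 by ring]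
    ring
  rw [h]
  exact integrable_const_mul_iff (by
    have : 0 < √(2 * Real.pi) := by positivity
    exact (inv_ne_zero this.ne').isUnit) _

theorem integral_Ioi_gaussWeight_le {x : ℝ} (hx : 0 ≤ x) :
    ∫ y in Set.Ioi x, gaussWeight y ≤ √(Real.pi / 2) * gaussWeight x := by
  have h1 : ∫ y in Set.Ioi x, gaussWeight (y - x) = √(Real.pi / 2) := by
    have h2 : ∫ y in Set.Ioi (0 : ℝ), gaussWeight y = √(Real.pi / 2) := by
      unfold gaussWeight
      rw [integral_gaussian_Ioi, show Real.pi / (1 / 2) = Real.pi / 2 * 2 ^ 2 by ring,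
        Real.sqrt_mul (by positivity), Real.sqrt_sq (by norm_num)]
      ring
    rw [← h2, ← integral_indicator measurableSet_Ioi, ← integral_indicator measurableSet_Ioi,
      ← integral_sub_right_eq_self ((Set.Ioi (0 : ℝ)).indicator gaussWeight) x]
    congr 1
    funext y
    simp [Set.indicator]
  calc ∫ y in Set.Ioi x, gaussWeight y
      ≤ ∫ y in Set.Ioi x, gaussWeight (y - x) * gaussWeight x := by
        refine setIntegral_mono_on integrable_gaussWeight.integrableOn
          ((integrable_gaussWeight.comp_sub_right x).mul_const _).integrableOn
          measurableSet_Ioi fun y hy => ?_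
        unfold gaussWeight
        rw [← Real.exp_add]
        apply Real.exp_le_exp.2
        have : x < y := hy
        nlinarith
    _ = _ := by rw [integral_mul_const, h1]

theorem tendsto_gaussWeight_atTop : Tendsto gaussWeight atTop (𝓝 0) := by
  unfold gaussWeight
  refine Real.tendsto_exp_atBot.comp ?_
  exact (tendsto_pow_atTop two_ne_zero).const_mul_atTop_of_neg (by norm_num)

theorem integrable_id_mul_gaussWeight : Integrable fun x => x * gaussWeight x :=
  integrable_mul_exp_neg_mul_sq (by norm_num)

theorem mul_integral_Ioi_gaussWeight_le (x : ℝ) :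
    x * ∫ y in Set.Ioi x, gaussWeight y ≤ gaussWeight x := by
  have h : ∫ y in Set.Ioi x, y * gaussWeight y = gaussWeight x := by
    have := integral_Ioi_of_hasDerivAt_of_tendsto' (a := x) (m := 0)
      (f := fun y => -gaussWeight y) (f' := fun y => y * gaussWeight y)
      (fun y _ => (hasDerivAt_gaussWeight y).neg.congr_deriv (by ring))
      integrable_id_mul_gaussWeight.integrableOn
      (by simpa using tendsto_gaussWeight_atTop.neg)
    simpa using this
  rw [← integral_const_mul, ← h]
  refine setIntegral_mono_on (integrable_gaussWeight.const_mul x).integrableOn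
    integrable_id_mul_gaussWeight.integrableOn measurableSet_Ioi fun y hy => ?_
  have : x < y := hy
  have := gaussWeight_pos y
  gcongr

/-- The solution `x ↦ e^{x²/2} ∫_{-∞}^x k(y) e^{-y²/2} dy` of Stein's equation
`f'(x) = x f(x) + k(x)`, which is bounded when `k` is bounded and centered. -/
noncomputable def steinSol (k : ℝ → ℝ) (x : ℝ) : ℝ :=
  (gaussWeight x)⁻¹ * ∫ y in Set.Iic x, k y * gaussWeight y

section

variable {k : ℝ → ℝ} {c : ℝ}

theorem integrable_mul_gaussWeight (hk : Continuous k) (hc : ∀ x, |k x| ≤ c) :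
    Integrable fun x => k x * gaussWeight x :=
  integrable_gaussWeight.bdd_mul hk.aestronglyMeasurable (ae_of_all _ hc)

theorem hasDerivAt_steinSol (hk : Continuous k) (hc : ∀ x, |k x| ≤ c) (x : ℝ) :
    HasDerivAt (steinSol k) (x * steinSol k x + k x) x := by
  have hi := integrable_mul_gaussWeight hk hc
  have hcont : Continuous fun x => k x * gaussWeight x :=
    hk.mul (contDiff_gaussWeight (n := 0)).continuous
  have h1 : HasDerivAt (fun x => ∫ y in Set.Iic x, k y * gaussWeight y)
      (k x * gaussWeight x) x := by
    have h2 : (fun x => ∫ y in Set.Iic x, k y * gaussWeight y)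
        = fun x => (∫ y in Set.Iic 0, k y * gaussWeight y)
          + ∫ y in (0 : ℝ)..x, k y * gaussWeight y := by
      funext x
      rw [← intervalIntegral.integral_Iic_sub_Iic hi.integrableOn hi.integrableOn]
      ring
    rw [h2]
    exact (intervalIntegral.integral_hasDerivAt_right hi.intervalIntegrable
      (hcont.stronglyMeasurableAtFilter _ _) hcont.continuousAt).const_add _
  have hw := (gaussWeight_pos x).ne'
  refine (((hasDerivAt_gaussWeight x).fun_inv hw).mul h1).congr_deriv ?_
  simp only [steinSol]
  field_simp

theorem abs_integral_Iic_le (hk : Continuous k) (hc : ∀ x, |k x| ≤ c)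
    (h0 : ∫ x, k x ∂gaussianReal 0 1 = 0) (x : ℝ) :
    |∫ y in Set.Iic x, k y * gaussWeight y| ≤ c * ∫ y in Set.Ioi |x|, gaussWeight y := by
  have hi := integrable_mul_gaussWeight hk hc
  have hb : ∀ s : Set ℝ, |∫ y in s, k y * gaussWeight y| ≤ c * ∫ y in s, gaussWeight y := by
    intro s
    rw [← integral_const_mul]
    refine (abs_integral_le_integral_abs).trans ?_
    refine integral_mono hi.abs.integrableOn
      (integrable_gaussWeight.const_mul c).integrableOn fun y => ?_
    simp only [abs_mul, abs_of_pos (gaussWeight_pos y)]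
    exact mul_le_mul_of_nonneg_right (hc y) (gaussWeight_pos y).le
  rcases le_total 0 x with hx | hx
  · have hz : ∫ y, k y * gaussWeight y = 0 := by
      rw [integral_gaussianReal_eq] at h0
      have : 0 < √(2 * Real.pi) := by positivity
      exact (mul_eq_zero.1 h0).resolve_left (inv_ne_zero this.ne')
    have hs := intervalIntegral.integral_Iic_add_Ioi (b := x) hi.integrableOn hi.integrableOn
    rw [hz] at hs
    rw [eq_neg_of_add_eq_zero_left hs, abs_neg, abs_of_nonneg hx]
    exact hb _
  · have hs : ∫ y in Set.Iic x, gaussWeight y = ∫ y in Set.Ioi |x|, gaussWeight y := by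
      rw [abs_of_nonpos hx, ← integral_comp_neg_Iic]
      simp only [gaussWeight_neg]
    rw [← hs]
    exact hb _

theorem gaussWeight_abs (x : ℝ) : gaussWeight |x| = gaussWeight x := by simp [gaussWeight]

theorem abs_steinSol_le (hk : Continuous k) (hc : ∀ x, |k x| ≤ c)
    (h0 : ∫ x, k x ∂gaussianReal 0 1 = 0) (x : ℝ) :
    |steinSol k x| ≤ c * √(Real.pi / 2) := by
  have hw := gaussWeight_pos x
  have hc0 : 0 ≤ c := (abs_nonneg _).trans (hc 0)
  rw [steinSol, abs_mul, abs_of_pos (inv_pos.2 hw), inv_mul_le_iff₀ hw]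
  refine (abs_integral_Iic_le hk hc h0 x).trans ?_
  have := integral_Ioi_gaussWeight_le (abs_nonneg x)
  rw [gaussWeight_abs] at this
  calc _ ≤ c * (√(Real.pi / 2) * gaussWeight x) := by gcongr
    _ = _ := by ring

theorem abs_mul_steinSol_le (hk : Continuous k) (hc : ∀ x, |k x| ≤ c)
    (h0 : ∫ x, k x ∂gaussianReal 0 1 = 0) (x : ℝ) : |x * steinSol k x| ≤ c := by
  have hw := gaussWeight_pos x
  have hc0 : 0 ≤ c := (abs_nonneg _).trans (hc 0)
  rw [steinSol, abs_mul, abs_mul, abs_of_pos (inv_pos.2 hw), mul_left_comm, inv_mul_le_iff₀ hw]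
  have := mul_integral_Ioi_gaussWeight_le |x|
  rw [gaussWeight_abs] at this
  calc _ ≤ |x| * (c * ∫ y in Set.Ioi |x|, gaussWeight y) := by
        gcongr
        exact abs_integral_Iic_le hk hc h0 x
    _ = c * (|x| * ∫ y in Set.Ioi |x|, gaussWeight y) := by ring
    _ ≤ c * gaussWeight x := by gcongr
    _ = _ := by ring

theorem deriv_steinSol (hk : Continuous k) (hc : ∀ x, |k x| ≤ c) (x : ℝ) :
    deriv (steinSol k) x = x * steinSol k x + k x :=
  (hasDerivAt_steinSol hk hc x).deriv

theorem abs_deriv_steinSol_le (hk : Continuous k) (hc : ∀ x, |k x| ≤ c)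
    (h0 : ∫ x, k x ∂gaussianReal 0 1 = 0) (x : ℝ) : |deriv (steinSol k) x| ≤ 2 * c := by
  rw [deriv_steinSol hk hc, two_mul]
  exact (abs_add_le _ _).trans (add_le_add (abs_mul_steinSol_le hk hc h0 x) (hc x))

theorem contDiff_steinSol (hk : ContDiff ℝ ((⊤ : ℕ∞) : WithTop ℕ∞) k) (hc : ∀ x, |k x| ≤ c) :
    ContDiff ℝ ((⊤ : ℕ∞) : WithTop ℕ∞) (steinSol k) := by
  rw [contDiff_infty]
  intro n
  have hd : Differentiable ℝ (steinSol k) := fun x =>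
    (hasDerivAt_steinSol hk.continuous hc x).differentiableAt
  induction n with
  | zero => exact contDiff_zero.2 hd.continuous
  | succ n ih =>
    rw [Nat.cast_succ, contDiff_succ_iff_deriv]
    refine ⟨hd, by simp, ?_⟩
    rw [funext (deriv_steinSol hk.continuous hc)]
    exact (contDiff_id.mul ih).add (hk.of_le (by exact_mod_cast le_top))

end

/-! ### The Gaussian Poincaré inequality -/

theorem integrable_of_continuous_of_abs_le {α : Type*} [TopologicalSpace α] [MeasurableSpace α]
    [OpensMeasurableSpace α] {ν : Measure α} [IsFiniteMeasure ν] {f : α → ℝ} {C : ℝ}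
    (hf : Continuous f) (hC : ∀ x, |f x| ≤ C) : Integrable f ν :=
  .of_bound hf.measurable.aestronglyMeasurable C (ae_of_all _ hC)

theorem abs_sq_le {a C : ℝ} (h : |a| ≤ C) : |a ^ 2| ≤ C ^ 2 := by
  rw [abs_pow]
  gcongr

theorem abs_mul_le {a b A B : ℝ} (ha : |a| ≤ A) (hb : |b| ≤ B) : |a * b| ≤ A * B := by
  rw [abs_mul]
  have := abs_nonneg a
  have := abs_nonneg b
  gcongr
  linarith

theorem sq_integral_le_integral_sq {α : Type*} [MeasurableSpace α] {ν : Measure α}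
    [IsProbabilityMeasure ν] {f : α → ℝ} (hf : MemLp f 2 ν) :
    (∫ x, f x ∂ν) ^ 2 ≤ ∫ x, f x ^ 2 ∂ν := by
  have h := variance_nonneg f ν
  rw [variance_eq_sub hf] at h
  simpa using h

/-- Gaussian integration by parts: `E[Z k(Z)] = E[k'(Z)]` for a standard normal `Z`. -/
theorem integral_mul_gaussianReal_eq {k k' : ℝ → ℝ} (hk : ∀ x, HasDerivAt k (k' x) x)
    (h0 : Integrable k (gaussianReal 0 1)) (h1 : Integrable k' (gaussianReal 0 1))
    (h2 : Integrable (fun x => x * k x) (gaussianReal 0 1)) :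
    ∫ x, x * k x ∂gaussianReal 0 1 = ∫ x, k' x ∂gaussianReal 0 1 := by
  rw [integrable_gaussianReal_iff] at h0 h1 h2
  have h := integral_mul_deriv_eq_deriv_mul_of_integrable (u := gaussWeight) (v := k)
    (fun x _ => hasDerivAt_gaussWeight x) (fun x _ => hk x)
    (by convert h1 using 1; funext x; simp [mul_comm])
    (by convert h2.neg using 1; funext x; simp; ring)
    (by convert h0 using 1; funext x; simp [mul_comm])
  rw [integral_gaussianReal_eq, integral_gaussianReal_eq]
  congr 1
  rw [← integral_neg] at h
  calc _ = ∫ x, -(-x * gaussWeight x * k x) := by congr 1; funext x; ring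
    _ = _ := by rw [← h]; congr 1; funext x; ring

/-- The one-dimensional Gaussian Poincaré inequality for centered functions. With `φ` the solution
of `φ' = x φ + g`, integration by parts gives `E g² = -E[φ g']` and `E g² = E φ'² + E φ²`. -/
theorem integral_sq_le_integral_deriv_sq_of_centered {g g' : ℝ → ℝ} {C : ℝ}
    (hd : ∀ x, HasDerivAt g (g' x) x) (hg' : Continuous g') (hC : ∀ x, |g x| ≤ C)
    (hC' : ∀ x, |g' x| ≤ C) (h0 : ∫ x, g x ∂gaussianReal 0 1 = 0) :
    ∫ x, g x ^ 2 ∂gaussianReal 0 1 ≤ ∫ x, g' x ^ 2 ∂gaussianReal 0 1 := by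
  have hg : Continuous g := continuous_iff_continuousAt.2 fun x => (hd x).continuousAt
  set φ := steinSol g with hφdef
  have hφd : ∀ x, HasDerivAt φ (x * φ x + g x) x := hasDerivAt_steinSol hg hC
  have hφ : Continuous φ := continuous_iff_continuousAt.2 fun x => (hφd x).continuousAt
  have b1 : ∀ x, |φ x| ≤ C * √(Real.pi / 2) := abs_steinSol_le hg hC h0
  have b2 : ∀ x, |x * φ x| ≤ C := abs_mul_steinSol_le hg hC h0
  have b3 : ∀ x, |x * φ x + g x| ≤ C + C := fun x =>
    (abs_add_le _ _).trans (add_le_add (b2 x) (hC x))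
  have I {f : ℝ → ℝ} {K : ℝ} (hf : Continuous f) (hK : ∀ x, |f x| ≤ K) :
      Integrable f (gaussianReal 0 1) := integrable_of_continuous_of_abs_le hf hK
  have ig2 : Integrable (fun x => g x ^ 2) (gaussianReal 0 1) :=
    I (by fun_prop) fun x => abs_sq_le (hC x)
  have ig'2 : Integrable (fun x => g' x ^ 2) (gaussianReal 0 1) :=
    I (by fun_prop) fun x => abs_sq_le (hC' x)
  have iφ2 : Integrable (fun x => φ x ^ 2) (gaussianReal 0 1) :=
    I (by fun_prop) fun x => abs_sq_le (b1 x)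
  have ixφ2 : Integrable (fun x => (x * φ x) ^ 2) (gaussianReal 0 1) :=
    I (by fun_prop) fun x => abs_sq_le (b2 x)
  have iφg' : Integrable (fun x => φ x * g' x) (gaussianReal 0 1) :=
    I (by fun_prop) fun x => abs_mul_le (b1 x) (hC' x)
  have iφ'g : Integrable (fun x => (x * φ x + g x) * g x) (gaussianReal 0 1) :=
    I (by fun_prop) fun x => abs_mul_le (b3 x) (hC x)
  have iφ'2 : Integrable (fun x => (x * φ x + g x) ^ 2) (gaussianReal 0 1) :=
    I (by fun_prop) fun x => abs_sq_le (b3 x)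
  have ixφg : Integrable (fun x => x * (φ x * g x)) (gaussianReal 0 1) := by
    refine I (K := C * C) (by fun_prop) fun x => ?_
    rw [← mul_assoc]
    exact abs_mul_le (b2 x) (hC x)
  have ixφφ' : Integrable (fun x => x * φ x * (x * φ x + g x)) (gaussianReal 0 1) :=
    I (by fun_prop) fun x => abs_mul_le (b2 x) (b3 x)
  have e1 : ∫ x, x * (φ x * g x) ∂gaussianReal 0 1
      = ∫ x, ((x * φ x + g x) * g x + φ x * g' x) ∂gaussianReal 0 1 :=
    integral_mul_gaussianReal_eq (k := fun x => φ x * g x) (fun x => (hφd x).mul (hd x))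
      (I (by fun_prop) fun x => abs_mul_le (b1 x) (hC x)) (iφ'g.add iφg') ixφg
  have e2 : ∫ x, x * (x * φ x ^ 2) ∂gaussianReal 0 1
      = ∫ x, (φ x ^ 2 + 2 * (x * φ x * (x * φ x + g x))) ∂gaussianReal 0 1 := by
    refine integral_mul_gaussianReal_eq (k := fun x => x * φ x ^ 2) (fun x => ?_) ?_
      (iφ2.add (ixφφ'.const_mul 2)) ?_
    · exact ((hasDerivAt_id x).mul ((hφd x).pow 2)).congr_deriv (by simp; ring)
    · refine I (K := C * (C * √(Real.pi / 2))) (by fun_prop) fun x => ?_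
      rw [pow_two, ← mul_assoc]
      exact abs_mul_le (b2 x) (b1 x)
    · convert ixφ2 using 2
      ring
  have s1 : ∫ x, g x ^ 2 ∂gaussianReal 0 1 = -∫ x, φ x * g' x ∂gaussianReal 0 1 := by
    rw [integral_add iφ'g iφg'] at e1
    have : ∫ x, g x ^ 2 ∂gaussianReal 0 1
        = ∫ x, ((x * φ x + g x) * g x - x * (φ x * g x)) ∂gaussianReal 0 1 := by
      congr 1; funext x; ring
    rw [this, integral_sub iφ'g ixφg, e1]
    ring
  have s2 : ∫ x, φ x ^ 2 ∂gaussianReal 0 1 ≤ ∫ x, g x ^ 2 ∂gaussianReal 0 1 := by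
    rw [integral_add iφ2 (ixφφ'.const_mul 2), integral_const_mul] at e2
    have h1 : ∫ x, x * (x * φ x ^ 2) ∂gaussianReal 0 1
        = ∫ x, (x * φ x) ^ 2 ∂gaussianReal 0 1 := by
      congr 1; funext x; ring
    have h2 : ∫ x, g x ^ 2 ∂gaussianReal 0 1 = ∫ x, ((x * φ x + g x) ^ 2
        + ((x * φ x) ^ 2 - 2 * (x * φ x * (x * φ x + g x)))) ∂gaussianReal 0 1 := by
      congr 1; funext x; ring
    have ixφ2' : Integrable (fun x => (x * φ x) ^ 2 - 2 * (x * φ x * (x * φ x + g x)))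
        (gaussianReal 0 1) := ixφ2.sub (ixφφ'.const_mul 2)
    rw [integral_add iφ'2 ixφ2',
      integral_sub ixφ2 (ixφφ'.const_mul 2), integral_const_mul] at h2
    have h3 : 0 ≤ ∫ x, (x * φ x + g x) ^ 2 ∂gaussianReal 0 1 :=
      integral_nonneg fun x => sq_nonneg _
    linarith
  have s3 : 0 ≤ ∫ x, (φ x ^ 2 + g' x ^ 2 + 2 * (φ x * g' x)) ∂gaussianReal 0 1 :=
    integral_nonneg fun x => by
      have := sq_nonneg (φ x + g' x)
      show 0 ≤ φ x ^ 2 + g' x ^ 2 + 2 * (φ x * g' x)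
      linarith
  have isum : Integrable (fun x => φ x ^ 2 + g' x ^ 2) (gaussianReal 0 1) := iφ2.add ig'2
  rw [integral_add isum (iφg'.const_mul 2), integral_add iφ2 ig'2,
    integral_const_mul] at s3
  linarith

theorem poincare_gaussianReal {g g' : ℝ → ℝ} {C : ℝ}
    (hd : ∀ x, HasDerivAt g (g' x) x) (hg' : Continuous g') (hC : ∀ x, |g x| ≤ C)
    (hC' : ∀ x, |g' x| ≤ C) :
    ∫ x, g x ^ 2 ∂gaussianReal 0 1
      ≤ (∫ x, g x ∂gaussianReal 0 1) ^ 2 + ∫ x, g' x ^ 2 ∂gaussianReal 0 1 := by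
  have hg : Continuous g := continuous_iff_continuousAt.2 fun x => (hd x).continuousAt
  have ig : Integrable g (gaussianReal 0 1) := integrable_of_continuous_of_abs_le hg hC
  have ig2 : Integrable (fun x => g x ^ 2) (gaussianReal 0 1) :=
    integrable_of_continuous_of_abs_le (by fun_prop) fun x => abs_sq_le (hC x)
  set m := ∫ x, g x ∂gaussianReal 0 1 with hm
  have h := integral_sq_le_integral_deriv_sq_of_centered (g := fun x => g x - m) (g' := g')
    (C := C + |m|) (fun x => (hd x).sub_const m) hg'
    (fun x => (abs_sub _ _).trans (by gcongr; exact hC x))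
    (fun x => (hC' x).trans (le_add_of_nonneg_right (abs_nonneg _)))
    (by rw [integral_sub ig (integrable_const _)]; simp [hm])
  have e : ∫ x, (g x - m) ^ 2 ∂gaussianReal 0 1
      = ∫ x, (g x ^ 2 - (2 * m * g x - m ^ 2)) ∂gaussianReal 0 1 := by
    congr 1; funext x; ring
  have ilin : Integrable (fun x => 2 * m * g x - m ^ 2) (gaussianReal 0 1) :=
    (ig.const_mul _).sub (integrable_const _)
  rw [e, integral_sub ig2 ilin,
    integral_sub (ig.const_mul _) (integrable_const _), integral_const_mul, ← hm] at h
  simp only [integral_const, probReal_univ, smul_eq_mul, one_mul] at h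
  linarith

/-- The standard Gaussian law on `ℝⁿ`. -/
noncomputable abbrev stdGauss (n : ℕ) : Measure (Fin n → ℝ) :=
  Measure.pi fun _ => gaussianReal 0 1

/-- The linear map `(x, y) ↦ Fin.cons x y`. -/
noncomputable def consL (n : ℕ) : ℝ × (Fin n → ℝ) →L[ℝ] (Fin (n + 1) → ℝ) :=
  ContinuousLinearMap.pi (Fin.cons (ContinuousLinearMap.fst ℝ ℝ (Fin n → ℝ)) fun i =>
    (ContinuousLinearMap.proj i).comp (ContinuousLinearMap.snd ℝ ℝ (Fin n → ℝ)))

theorem consL_apply {n : ℕ} (x : ℝ) (y : Fin n → ℝ) : consL n (x, y) = Fin.cons x y := by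
  funext i
  refine Fin.cases ?_ (fun i => ?_) i <;> simp [consL]

theorem integral_stdGauss_succ {n : ℕ} (f : (Fin (n + 1) → ℝ) → ℝ) :
    ∫ z, f z ∂stdGauss (n + 1)
      = ∫ p, f (consL n p) ∂(gaussianReal 0 1).prod (stdGauss n) := by
  have h := (measurePreserving_piFinSuccAbove
    (fun _ : Fin (n + 1) => gaussianReal 0 1) 0).symm
  rw [← h.integral_comp' f]
  congr 1
  funext p
  congr 1
  rw [← Prod.mk.eta (p := p), consL_apply]
  simp [MeasurableEquiv.piFinSuccAbove, Fin.insertNthEquiv]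

/-- The Gaussian Poincaré inequality on `ℝⁿ`, by tensorization. -/
theorem poincare_stdGauss (n : ℕ) : ∀ {g : (Fin n → ℝ) → ℝ} {C : ℝ}, ContDiff ℝ 1 g →
    (∀ x, |g x| ≤ C) → (∀ x, ‖fderiv ℝ g x‖ ≤ C) →
    ∫ x, g x ^ 2 ∂stdGauss n
      ≤ (∫ x, g x ∂stdGauss n) ^ 2
        + ∫ x, ∑ i, (fderiv ℝ g x (Pi.single i 1)) ^ 2 ∂stdGauss n := by
  induction n with
  | zero =>
    intro g C _ _ _
    have hg : g = fun _ => g 0 := funext fun x => congrArg g (Subsingleton.elim _ _)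
    rw [hg]
    simp
  | succ n ih =>
    intro f C hf hC hC'
    set γ := gaussianReal 0 1 with hγ
    set g : ℝ × (Fin n → ℝ) → ℝ := f ∘ consL n with hg
    have hgd : ContDiff ℝ 1 g := hf.comp (consL n).contDiff
    have hgC : ∀ p, |g p| ≤ C := fun p => hC _
    have hgf : ∀ p, fderiv ℝ g p = (fderiv ℝ f (consL n p)).comp (consL n) := fun p => by
      rw [hg, fderiv_comp _ (hf.differentiable one_ne_zero _) (consL n).differentiableAt,
        ContinuousLinearMap.fderiv]
    obtain ⟨K, hK⟩ : ∃ K, ∀ p, ‖fderiv ℝ g p‖ ≤ K := ⟨C * ‖consL n‖, fun p => by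
      rw [hgf]
      exact (ContinuousLinearMap.opNorm_comp_le _ _).trans (by gcongr; exact hC' _)⟩
    have hfg : Continuous (fderiv ℝ g) := hgd.continuous_fderiv one_ne_zero
    have hgc : Continuous g := hgd.continuous
    -- averaging over the first coordinate commutes with differentiation in the others
    set G : (Fin n → ℝ) → ℝ := fun y => ∫ x, g (x, y) ∂γ with hG
    set G' : (Fin n → ℝ) → (Fin n → ℝ) →L[ℝ] ℝ := fun y =>
      ∫ x, (fderiv ℝ g (x, y)).comp (ContinuousLinearMap.inr ℝ ℝ (Fin n → ℝ)) ∂γ with hG'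
    have hb : ∀ p, ‖(fderiv ℝ g p).comp (ContinuousLinearMap.inr ℝ ℝ (Fin n → ℝ))‖ ≤ K := fun p =>
      (ContinuousLinearMap.opNorm_comp_le _ _).trans <| by
        have h1 := ContinuousLinearMap.norm_inr_le_one ℝ ℝ (Fin n → ℝ)
        have h2 : 0 ≤ K := (norm_nonneg _).trans (hK p)
        calc _ ≤ K * 1 := by gcongr; exact hK p
          _ = K := mul_one _
    have hcd : Continuous fun p => (fderiv ℝ g p).comp (ContinuousLinearMap.inr ℝ ℝ (Fin n → ℝ)) := by
      fun_prop
    have hG'i : ∀ y, Integrable (fun x => (fderiv ℝ g (x, y)).comp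
        (ContinuousLinearMap.inr ℝ ℝ (Fin n → ℝ))) γ := fun y =>
      .of_bound (by
        have : Continuous fun x => (fderiv ℝ g (x, y)).comp (ContinuousLinearMap.inr ℝ ℝ (Fin n → ℝ)) :=
          by fun_prop
        exact this.aestronglyMeasurable) K (ae_of_all _ fun x => hb _)
    have hGd : ∀ y, HasFDerivAt G (G' y) y := fun y => by
      refine hasFDerivAt_integral_of_dominated_of_fderiv_le (bound := fun _ => K)
        (F' := fun y x => (fderiv ℝ g (x, y)).comp (ContinuousLinearMap.inr ℝ ℝ (Fin n → ℝ)))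
        (s := Set.univ) Filter.univ_mem ?_ ?_ (hG'i y).aestronglyMeasurable
        (ae_of_all _ fun x z _ => hb _) (integrable_const _) (ae_of_all _ fun x z _ => ?_)
      · refine Eventually.of_forall fun z => ?_
        have : Continuous fun x => g (x, z) := by fun_prop
        exact this.aestronglyMeasurable
      · exact integrable_of_continuous_of_abs_le (by fun_prop) fun x => hgC _
      · exact ((hgd.differentiable one_ne_zero (x, z)).hasFDerivAt).comp z
          (hasFDerivAt_prodMk_right x z)
    have hG'c : Continuous G' := by
      refine continuous_of_dominated (bound := fun _ => K)
        (fun y => (hG'i y).aestronglyMeasurable) (fun y => ae_of_all _ fun x => hb _)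
        (integrable_const _) (ae_of_all _ fun x => ?_)
      fun_prop
    have hfG : fderiv ℝ G = G' := funext fun y => (hGd y).fderiv
    have hGcd : ContDiff ℝ 1 G := by
      rw [contDiff_one_iff_fderiv]
      exact ⟨fun y => (hGd y).differentiableAt, hfG ▸ hG'c⟩
    have hGC : ∀ y, |G y| ≤ C := fun y => by
      have := norm_integral_le_of_norm_le_const (μ := γ) (f := fun x => g (x, y))
        (ae_of_all _ fun x => hgC _)
      simpa using this
    have hG'C : ∀ y, ‖G' y‖ ≤ K := fun y => by
      have := norm_integral_le_of_norm_le_const (μ := γ) (C := K)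
        (f := fun x => (fderiv ℝ g (x, y)).comp (ContinuousLinearMap.inr ℝ ℝ (Fin n → ℝ)))
        (ae_of_all _ fun x => hb _)
      simpa using this
    have hIH := ih (C := max C K) hGcd (fun y => (hGC y).trans (le_max_left _ _))
      (fun y => by rw [hfG]; exact (hG'C y).trans (le_max_right _ _))
    -- the partial derivatives of `g` in the two groups of variables
    set d : Fin (n + 1) → ℝ × (Fin n → ℝ) → ℝ := fun i p => fderiv ℝ f (consL n p) (Pi.single i 1)
      with hd
    have hdc : ∀ i, Continuous (d i) := fun i => by
      have := hf.continuous_fderiv one_ne_zero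
      fun_prop
    have hdC : ∀ i p, |d i p| ≤ C := fun i p =>
      ((fderiv ℝ f (consL n p)).le_opNorm _).trans (by simpa [Pi.norm_single] using hC' _)
    have hd0 : ∀ p, fderiv ℝ g p (1, 0) = d 0 p := fun p => by
      simp only [hgf, hd, ContinuousLinearMap.comp_apply, consL_apply]
      congr 1
      funext i
      refine Fin.cases ?_ (fun i => ?_) i <;> simp
    have hds : ∀ (i : Fin n) p, fderiv ℝ g p (0, Pi.single i 1) = d i.succ p := fun i p => by
      simp only [hgf, hd, ContinuousLinearMap.comp_apply, consL_apply]
      congr 1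
      funext j
      refine Fin.cases ?_ (fun j => ?_) j <;> simp [Pi.single_apply]
    have id2 : ∀ i, Integrable (fun p => d i p ^ 2) (γ.prod (stdGauss n)) := fun i =>
      integrable_of_continuous_of_abs_le ((hdc i).pow 2) fun p => abs_sq_le (hdC i p)
    have ig : Integrable g (γ.prod (stdGauss n)) := integrable_of_continuous_of_abs_le hgc hgC
    have ig2 : Integrable (fun p => g p ^ 2) (γ.prod (stdGauss n)) :=
      integrable_of_continuous_of_abs_le (hgc.pow 2) fun p => abs_sq_le (hgC p)
    have hmean : ∫ p, g p ∂γ.prod (stdGauss n) = ∫ y, G y ∂stdGauss n :=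
      integral_prod_symm _ ig
    have iG2 : Integrable (fun y => G y ^ 2) (stdGauss n) :=
      integrable_of_continuous_of_abs_le (hGcd.continuous.pow 2) fun y => abs_sq_le (hGC y)
    have i0 : Integrable (fun y => ∫ x, d 0 (x, y) ^ 2 ∂γ) (stdGauss n) :=
      (id2 0).integral_prod_right
    have h1 : ∫ p, g p ^ 2 ∂γ.prod (stdGauss n)
        ≤ ∫ y, G y ^ 2 ∂stdGauss n + ∫ p, d 0 p ^ 2 ∂γ.prod (stdGauss n) := by
      rw [integral_prod_symm _ ig2, integral_prod_symm _ (id2 0), ← integral_add iG2 i0]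
      refine integral_mono ig2.integral_prod_right (iG2.add i0) fun y => ?_
      refine poincare_gaussianReal (C := max C K) (fun x => ?_)
        ((hdc 0).comp (by fun_prop : Continuous fun x => (x, y)))
        (fun x => (hgC _).trans (le_max_left _ _)) (fun x => (hdC _ _).trans (le_max_left _ _))
      have := ((hgd.differentiable one_ne_zero (x, y)).hasFDerivAt).comp_hasDerivAt x
        ((hasDerivAt_id x).prodMk (hasDerivAt_const x y))
      rw [hd0] at this
      exact this
    have h2 : ∫ y, ∑ i, (fderiv ℝ G y (Pi.single i 1)) ^ 2 ∂stdGauss n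
        ≤ ∑ i : Fin n, ∫ p, d i.succ p ^ 2 ∂γ.prod (stdGauss n) := by
      have hval : ∀ y (i : Fin n), fderiv ℝ G y (Pi.single i 1) = ∫ x, d i.succ (x, y) ∂γ := by
        intro y i
        rw [hfG, hG', ContinuousLinearMap.integral_apply (hG'i y)]
        congr 1
        funext x
        rw [← hds]
        simp
      have hle : ∀ y (i : Fin n), (fderiv ℝ G y (Pi.single i 1)) ^ 2
          ≤ ∫ x, d i.succ (x, y) ^ 2 ∂γ := by
        intro y i
        rw [hval]
        refine sq_integral_le_integral_sq (.of_bound ?_ C (ae_of_all _ fun x => hdC _ _))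
        exact ((hdc i.succ).comp (by fun_prop : Continuous fun x => (x, y))).aestronglyMeasurable
      have hint : ∀ i : Fin n, Integrable (fun y => (fderiv ℝ G y (Pi.single i 1)) ^ 2)
          (stdGauss n) := fun i => by
        refine integrable_of_continuous_of_abs_le (C := K ^ 2) ?_ fun y => abs_sq_le ?_
        · rw [hfG]
          fun_prop
        · rw [hfG]
          exact ((G' y).le_opNorm _).trans (by simpa [Pi.norm_single] using hG'C y)
      rw [integral_finsetSum _ fun i _ => hint i]
      refine Finset.sum_le_sum fun i _ => ?_
      rw [integral_prod_symm _ (id2 _)]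
      exact integral_mono (hint i) (id2 _).integral_prod_right fun y => hle y i
    rw [integral_stdGauss_succ, integral_stdGauss_succ, integral_stdGauss_succ]
    have h3 : ∫ p, ∑ i, (fderiv ℝ f (consL n p) (Pi.single i 1)) ^ 2 ∂γ.prod (stdGauss n)
        = ∫ p, d 0 p ^ 2 ∂γ.prod (stdGauss n)
          + ∑ i : Fin n, ∫ p, d i.succ p ^ 2 ∂γ.prod (stdGauss n) := by
      rw [integral_finsetSum _ fun i _ => id2 i, Fin.sum_univ_succ]
    rw [h3]
    change ∫ p, g p ^ 2 ∂γ.prod (stdGauss n) ≤ (∫ p, g p ∂γ.prod (stdGauss n)) ^ 2 + _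
    rw [hmean]
    linarith

/-! ### The chain rule for the Malliavin derivative -/

section BoundedDerivatives

variable {E E' F G : Type*} [NormedAddCommGroup E] [NormedSpace ℝ E] [NormedAddCommGroup E']
  [NormedSpace ℝ E'] [NormedAddCommGroup F] [NormedSpace ℝ F] [NormedAddCommGroup G]
  [NormedSpace ℝ G]

/-- A smooth function that is bounded together with all its derivatives. -/
def SmoothBounded (f : E → F) : Prop :=
  ContDiff ℝ ((⊤ : ℕ∞) : WithTop ℕ∞) f ∧ ∀ k : ℕ, ∃ C : ℝ, ∀ x, ‖iteratedFDeriv ℝ k f x‖ ≤ C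

theorem SmoothBounded.comp_clm {f : E → F} (hf : SmoothBounded f) (L : E' →L[ℝ] E) :
    SmoothBounded fun x => f (L x) := by
  refine ⟨hf.1.comp L.contDiff, fun k => ?_⟩
  obtain ⟨C, hC⟩ := hf.2 k
  refine ⟨C * ∏ _ : Fin k, ‖L‖, fun x => ?_⟩
  have := L.iteratedFDeriv_comp_right hf.1 x (i := k) (by exact_mod_cast le_top)
  change ‖iteratedFDeriv ℝ k (f ∘ L) x‖ ≤ _
  rw [this]
  refine (ContinuousMultilinearMap.norm_compContinuousLinearMap_le _ _).trans ?_
  gcongr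
  exact hC _

theorem SmoothBounded.prodMk {f : E → F} {g : E → G} (hf : SmoothBounded f)
    (hg : SmoothBounded g) : SmoothBounded fun x => (f x, g x) := by
  refine ⟨hf.1.prodMk hg.1, fun k => ?_⟩
  obtain ⟨C, hC⟩ := hf.2 k
  obtain ⟨C', hC'⟩ := hg.2 k
  refine ⟨max C C', fun x => ?_⟩
  rw [iteratedFDeriv_prodMk hf.1.contDiffAt hg.1.contDiffAt (by exact_mod_cast le_top),
    ContinuousMultilinearMap.opNorm_prod]
  exact max_le_max (hC x) (hC' x)

/-- Composition with an arbitrary smooth function preserves `SmoothBounded`: as the inner function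
is bounded, only the values of the outer derivatives on a compact ball matter. -/
theorem SmoothBounded.comp [ProperSpace F] {f : E → F} (hf : SmoothBounded f) {Φ : F → G}
    (hΦ : ContDiff ℝ ((⊤ : ℕ∞) : WithTop ℕ∞) Φ) : SmoothBounded fun x => Φ (f x) := by
  refine ⟨hΦ.comp hf.1, fun k => ?_⟩
  choose C hC using hf.2
  have hK : ∀ i : ℕ, ∃ K, ∀ y ∈ Metric.closedBall (0 : F) (C 0),
      ‖iteratedFDeriv ℝ i Φ y‖ ≤ K := fun i =>
    (isCompact_closedBall (0 : F) (C 0)).exists_bound_of_continuousOn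
      (hΦ.continuous_iteratedFDeriv (by exact_mod_cast le_top)).continuousOn
  choose K hK using hK
  have hmem : ∀ x, f x ∈ Metric.closedBall (0 : F) (C 0) := fun x => by
    simpa using hC 0 x
  set D := 1 + ∑ i ∈ Finset.range (k + 1), |C i|
  set M := ∑ i ∈ Finset.range (k + 1), |K i|
  refine ⟨_, fun x => norm_iteratedFDeriv_comp_le hΦ hf.1 (n := k) (by exact_mod_cast le_top) x
    (C := M) (D := D) (fun i hi => ?_) (fun i h1 hi => ?_)⟩
  · exact ((hK i _ (hmem x)).trans (le_abs_self _)).trans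
      (Finset.single_le_sum (f := fun i => |K i|) (fun _ _ => abs_nonneg _)
        (Finset.mem_range.2 (by omega)))
  · have h2 : |C i| ≤ ∑ i ∈ Finset.range (k + 1), |C i| :=
      Finset.single_le_sum (f := fun i => |C i|) (fun _ _ => abs_nonneg _)
        (Finset.mem_range.2 (by omega))
    have h3 : 1 ≤ D := le_add_of_nonneg_right (Finset.sum_nonneg fun _ _ => abs_nonneg _)
    calc ‖iteratedFDeriv ℝ i f x‖ ≤ |C i| := (hC i x).trans (le_abs_self _)
      _ ≤ D := by simp only [D]; linarith
      _ ≤ D ^ i := le_self_pow₀ h3 (by omega)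

end BoundedDerivatives

section

variable {Ω H : Type*} [MeasurableSpace Ω] [NormedAddCommGroup H] [InnerProductSpace ℝ H]
  {X : H → Ω → ℝ} {P : Measure Ω}

theorem Cylindrical.smoothBounded (S : Cylindrical H) : SmoothBounded S.f :=
  ⟨S.smooth, S.bounded⟩

/-- The projection `ℝ^{m+n} → ℝᵐ` onto the first coordinates. -/
def leftL (m n : ℕ) : (Fin (m + n) → ℝ) →L[ℝ] (Fin m → ℝ) :=
  ContinuousLinearMap.pi fun i => ContinuousLinearMap.proj (Fin.castAdd n i)

/-- The projection `ℝ^{m+n} → ℝⁿ` onto the last coordinates. -/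
def rightL (m n : ℕ) : (Fin (m + n) → ℝ) →L[ℝ] (Fin n → ℝ) :=
  ContinuousLinearMap.pi fun i => ContinuousLinearMap.proj (Fin.natAdd m i)

/-- The cylindrical random variable `Φ(S, T)`. -/
def Cylindrical.comp₂ (S T : Cylindrical H) (Φ : ℝ × ℝ → ℝ)
    (hΦ : ContDiff ℝ ((⊤ : ℕ∞) : WithTop ℕ∞) Φ) : Cylindrical H where
  n := S.n + T.n
  φ := Fin.append S.φ T.φ
  f := fun x => Φ (S.f (leftL S.n T.n x), T.f (rightL S.n T.n x))
  smooth := (((S.smoothBounded.comp_clm (leftL S.n T.n)).prodMk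
    (T.smoothBounded.comp_clm (rightL S.n T.n))).comp hΦ).1
  bounded := (((S.smoothBounded.comp_clm (leftL S.n T.n)).prodMk
    (T.smoothBounded.comp_clm (rightL S.n T.n))).comp hΦ).2

theorem Cylindrical.leftL_vec (S T : Cylindrical H) (Φ : ℝ × ℝ → ℝ)
    (hΦ : ContDiff ℝ ((⊤ : ℕ∞) : WithTop ℕ∞) Φ) (ω : Ω) :
    leftL S.n T.n ((S.comp₂ T Φ hΦ).vec X ω) = S.vec X ω := by
  funext i
  simp [leftL, Cylindrical.vec, Cylindrical.comp₂]

theorem Cylindrical.rightL_vec (S T : Cylindrical H) (Φ : ℝ × ℝ → ℝ)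
    (hΦ : ContDiff ℝ ((⊤ : ℕ∞) : WithTop ℕ∞) Φ) (ω : Ω) :
    rightL S.n T.n ((S.comp₂ T Φ hΦ).vec X ω) = T.vec X ω := by
  funext i
  simp [rightL, Cylindrical.vec, Cylindrical.comp₂]

theorem Cylindrical.comp₂_val (S T : Cylindrical H) (Φ : ℝ × ℝ → ℝ)
    (hΦ : ContDiff ℝ ((⊤ : ℕ∞) : WithTop ℕ∞) Φ) (ω : Ω) :
    (S.comp₂ T Φ hΦ).val X ω = Φ (S.val X ω, T.val X ω) := by
  unfold Cylindrical.val
  rw [← S.leftL_vec T Φ hΦ, ← S.rightL_vec T Φ hΦ]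
  rfl

theorem Cylindrical.comp₂_deriv (S T : Cylindrical H) (Φ : ℝ × ℝ → ℝ)
    (hΦ : ContDiff ℝ ((⊤ : ℕ∞) : WithTop ℕ∞) Φ) (ω : Ω) :
    (S.comp₂ T Φ hΦ).deriv X ω
      = fderiv ℝ Φ (S.val X ω, T.val X ω) (1, 0) • S.deriv X ω
        + fderiv ℝ Φ (S.val X ω, T.val X ω) (0, 1) • T.deriv X ω := by
  set x : Fin (S.n + T.n) → ℝ := (S.comp₂ T Φ hΦ).vec X ω with hx
  have hl : leftL S.n T.n x = S.vec X ω := S.leftL_vec T Φ hΦ ω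
  have hr : rightL S.n T.n x = T.vec X ω := S.rightL_vec T Φ hΦ ω
  set f : (Fin (S.n + T.n) → ℝ) → ℝ :=
    fun x => Φ (S.f (leftL S.n T.n x), T.f (rightL S.n T.n x)) with hf
  have hfd : ∀ v, fderiv ℝ f x v
      = fderiv ℝ Φ (S.val X ω, T.val X ω) (fderiv ℝ S.f (S.vec X ω) (leftL S.n T.n v),
        fderiv ℝ T.f (T.vec X ω) (rightL S.n T.n v)) := by
    intro v
    have h1 : HasFDerivAt S.f (fderiv ℝ S.f (S.vec X ω)) (leftL S.n T.n x) :=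
      hl ▸ (S.smooth.differentiable (by simp) _).hasFDerivAt
    have h2 : HasFDerivAt T.f (fderiv ℝ T.f (T.vec X ω)) (rightL S.n T.n x) :=
      hr ▸ (T.smooth.differentiable (by simp) _).hasFDerivAt
    have h3 := (h1.comp x (leftL S.n T.n).hasFDerivAt).prodMk
      (h2.comp x (rightL S.n T.n).hasFDerivAt)
    have h4 : HasFDerivAt Φ (fderiv ℝ Φ (S.val X ω, T.val X ω))
        (S.f (leftL S.n T.n x), T.f (rightL S.n T.n x)) := by
      rw [hl, hr]
      exact (hΦ.differentiable (by simp) _).hasFDerivAt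
    have h5 : HasFDerivAt f _ x :=
      HasFDerivAt.comp (f := fun x => (S.f (leftL S.n T.n x), T.f (rightL S.n T.n x))) x h4 h3
    rw [h5.fderiv]
    rfl
  have e1 : ∀ i, leftL S.n T.n (Pi.single (Fin.castAdd T.n i) 1) = Pi.single i 1 := fun i => by
    funext j
    simp [leftL, Pi.single_apply]
  have e2 : ∀ i, rightL S.n T.n (Pi.single (Fin.castAdd T.n i) 1) = 0 := fun i => by
    funext j
    have : Fin.natAdd S.n j ≠ Fin.castAdd T.n i := by
      intro h
      have := congrArg Fin.val h
      simp at this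
      omega
    simp [rightL, this]
  have e3 : ∀ i, leftL S.n T.n (Pi.single (Fin.natAdd S.n i) 1) = 0 := fun i => by
    funext j
    have : Fin.castAdd T.n j ≠ Fin.natAdd S.n i := by
      intro h
      have := congrArg Fin.val h
      simp at this
      omega
    simp [leftL, this]
  have e4 : ∀ i, rightL S.n T.n (Pi.single (Fin.natAdd S.n i) 1) = Pi.single i 1 := fun i => by
    funext j
    simp [rightL, Pi.single_apply]
  change ∑ i : Fin (S.n + T.n), fderiv ℝ f x (Pi.single i 1)
    • Fin.append S.φ T.φ i = _
  rw [Fin.sum_univ_add]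
  simp only [hfd, e1, e2, e3, e4, Fin.append_left, Fin.append_right, map_zero]
  have s1 : ∀ (L : ℝ × ℝ →L[ℝ] ℝ) (a : ℝ), L (a, 0) = L (1, 0) * a := fun L a => by
    rw [mul_comm, ← smul_eq_mul, ← map_smul]
    simp
  have s2 : ∀ (L : ℝ × ℝ →L[ℝ] ℝ) (b : ℝ), L (0, b) = L (0, 1) * b := fun L b => by
    rw [mul_comm, ← smul_eq_mul, ← map_smul]
    simp
  simp only [s1 _ (fderiv ℝ S.f _ _), s2 _ (fderiv ℝ T.f _ _), Cylindrical.deriv,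
    Finset.smul_sum, smul_smul]

theorem Cylindrical.measurable_val (S : Cylindrical H) (hX : ∀ φ, Measurable (X φ)) :
    Measurable (S.val X) :=
  S.smooth.continuous.measurable.comp (measurable_pi_lambda _ fun _ => hX _)

/-- Dominated convergence in `L²` for products of bounded, almost everywhere convergent
coefficients with an `L²`-convergent sequence. -/
theorem tendsto_eLpNorm_smul_sub {a : ℕ → Ω → ℝ} {a₀ : Ω → ℝ} {G : ℕ → Ω → H} {G₀ : Ω → H}
    {C : ℝ} (ham : ∀ n, AEStronglyMeasurable (a n) P) (ham₀ : AEStronglyMeasurable a₀ P)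
    (ha : ∀ n ω, |a n ω| ≤ C) (hlim : ∀ᵐ ω ∂P, Tendsto (fun n => a n ω) atTop (𝓝 (a₀ ω)))
    (hG : ∀ n, AEStronglyMeasurable (G n) P) (hG₀ : MemLp G₀ 2 P)
    (hGlim : Tendsto (fun n => eLpNorm (fun ω => G n ω - G₀ ω) 2 P) atTop (𝓝 0)) :
    Tendsto (fun n => eLpNorm (fun ω => a n ω • G n ω - a₀ ω • G₀ ω) 2 P) atTop (𝓝 0) := by
  have ha₀ : ∀ᵐ ω ∂P, |a₀ ω| ≤ C := hlim.mono fun ω h =>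
    le_of_tendsto h.abs (Eventually.of_forall fun n => ha n ω)
  have h1 : Tendsto (fun n => ENNReal.ofReal C * eLpNorm (fun ω => G n ω - G₀ ω) 2 P)
      atTop (𝓝 0) := by
    simpa using ENNReal.Tendsto.const_mul hGlim (Or.inr ENNReal.ofReal_ne_top)
  have h2 : Tendsto (fun n => eLpNorm (fun ω => (a n ω - a₀ ω) • G₀ ω) 2 P) atTop (𝓝 0) := by
    have hsq : Tendsto (fun n => ∫⁻ ω, ‖(a n ω - a₀ ω) • G₀ ω‖ₑ ^ (2 : ℝ) ∂P) atTop
        (𝓝 (∫⁻ _, 0 ∂P)) := by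
      refine tendsto_lintegral_of_dominated_convergence'
        (fun ω => ENNReal.ofReal (2 * C) ^ (2 : ℝ) * ‖G₀ ω‖ₑ ^ (2 : ℝ)) (fun n => ?_)
        (fun n => ?_) ?_ ?_
      · exact (((ham n).sub ham₀).smul hG₀.1).enorm.pow_const _
      · filter_upwards [ha₀] with ω hω
        rw [enorm_smul, ENNReal.mul_rpow_of_nonneg _ _ (by norm_num)]
        gcongr
        rw [Real.enorm_eq_ofReal_abs]
        apply ENNReal.ofReal_le_ofReal
        have := abs_sub (a n ω) (a₀ ω)
        have := ha n ω
        linarith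
      · have htop : ENNReal.ofReal (2 * C) ^ (2 : ℝ) ≠ ∞ :=
          ENNReal.rpow_ne_top_of_nonneg (by norm_num) ENNReal.ofReal_ne_top
        rw [lintegral_const_mul' _ _ htop]
        refine ENNReal.mul_ne_top htop ?_
        have := lintegral_rpow_enorm_lt_top_of_eLpNorm_lt_top (p := 2) (by simp) (by simp) hG₀.2
        simpa using this.ne
      · filter_upwards [hlim] with ω hω
        have h3 : Tendsto (fun n => (a n ω - a₀ ω) • G₀ ω) atTop (𝓝 0) := by
          have := (hω.sub_const (a₀ ω)).smul_const (G₀ ω)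
          simpa using this
        have h4 := h3.enorm
        rw [enorm_zero] at h4
        have := (ENNReal.continuous_rpow_const (y := (2 : ℝ))).tendsto 0 |>.comp h4
        rwa [ENNReal.zero_rpow_of_pos (by norm_num)] at this
    rw [lintegral_zero] at hsq
    have := (ENNReal.continuous_rpow_const (y := (1 / 2 : ℝ))).tendsto 0 |>.comp hsq
    rw [ENNReal.zero_rpow_of_pos (by norm_num)] at this
    refine this.congr fun n => ?_
    rw [eLpNorm_eq_lintegral_rpow_enorm_toReal (by simp) (by simp)]
    simp
  have h3 := h1.add h2
  rw [add_zero] at h3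
  refine tendsto_of_tendsto_of_tendsto_of_le_of_le tendsto_const_nhds h3 (fun _ => zero_le)
    fun n => ?_
  have e : (fun ω => a n ω • G n ω - a₀ ω • G₀ ω)
      = (fun ω => a n ω • (G n ω - G₀ ω)) + fun ω => (a n ω - a₀ ω) • G₀ ω := by
    funext ω
    simp only [Pi.add_apply, smul_sub, sub_smul]
    abel
  simp only [e]
  refine (eLpNorm_add_le ((ham n).smul ((hG n).sub hG₀.1))
    (((ham n).sub ham₀).smul hG₀.1) (by norm_num)).trans ?_
  refine add_le_add ?_ le_rfl
  refine eLpNorm_le_mul_eLpNorm_of_ae_le_mul (ae_of_all _ fun ω => ?_) 2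
  change ‖a n ω • (G n ω - G₀ ω)‖ ≤ _
  rw [norm_smul]
  gcongr
  exact ha n ω

/-- The chain rule: for a smooth `Φ : ℝ² → ℝ` with bounded gradient, `Φ(A, B)` belongs to `𝔻^{1,2}`
whenever `A` and `B` do. -/
theorem HasDeriv.comp₂ [IsFiniteMeasure P] (hX : ∀ φ, Measurable (X φ)) {A B : Ω → ℝ}
    {DA DB : Ω → H} (hA : HasDeriv X P A DA) (hB : HasDeriv X P B DB) {Φ : ℝ × ℝ → ℝ}
    (hΦ : ContDiff ℝ ((⊤ : ℕ∞) : WithTop ℕ∞) Φ) {C : ℝ} (hC : ∀ p, ‖fderiv ℝ Φ p‖ ≤ C) :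
    HasDeriv X P (fun ω => Φ (A ω, B ω)) (fun ω => fderiv ℝ Φ (A ω, B ω) (1, 0) • DA ω
      + fderiv ℝ Φ (A ω, B ω) (0, 1) • DB ω) := by
  obtain ⟨hA2, hDA2, S, hS, hDS⟩ := hA
  obtain ⟨hB2, hDB2, T, hT, hDT⟩ := hB
  -- a common subsequence along which both approximations converge almost everywhere
  obtain ⟨s, hs, hsae⟩ := (tendstoInMeasure_of_tendsto_eLpNorm two_ne_zero
    (fun n => ((S n).measurable_val hX).aestronglyMeasurable) hA2.1 hS).exists_seq_tendsto_ae
  obtain ⟨t, ht, htae⟩ := (tendstoInMeasure_of_tendsto_eLpNorm two_ne_zero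
    (fun n => ((T (s n)).measurable_val hX).aestronglyMeasurable) hB2.1
    (hT.comp hs.tendsto_atTop)).exists_seq_tendsto_ae
  have hst : Tendsto (fun n => s (t n)) atTop atTop := hs.tendsto_atTop.comp ht.tendsto_atTop
  set S' : ℕ → Cylindrical H := fun n => S (s (t n)) with hS'
  set T' : ℕ → Cylindrical H := fun n => T (s (t n)) with hT'
  replace hS := hS.comp hst
  replace hDS := hDS.comp hst
  replace hT := hT.comp hst
  replace hDT := hDT.comp hst
  have hC0 : 0 ≤ C := (norm_nonneg _).trans (hC 0)
  have hlip : ∀ p q, |Φ p - Φ q| ≤ C * ‖p - q‖ := fun p q =>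
    convex_univ.norm_image_sub_le_of_norm_fderiv_le
      (fun x _ => hΦ.differentiable (by simp) x) (fun x _ => hC x) (Set.mem_univ q)
      (Set.mem_univ p)
  have hΦc : Continuous Φ := hΦ.continuous
  have hdc : Continuous (fderiv ℝ Φ) := hΦ.continuous_fderiv (by simp)
  have hpair : AEStronglyMeasurable (fun ω => (A ω, B ω)) P := hA2.1.prodMk hB2.1
  have hpn : ∀ n, AEStronglyMeasurable (fun ω => ((S' n).val X ω, (T' n).val X ω)) P := fun n =>
    (((S' n).measurable_val hX).prodMk ((T' n).measurable_val hX)).aestronglyMeasurable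
  have hdm : ∀ v : ℝ × ℝ, Continuous fun p => fderiv ℝ Φ p v := fun v => by fun_prop
  have hdb : ∀ (v : ℝ × ℝ), ‖v‖ ≤ 1 → ∀ p, |fderiv ℝ Φ p v| ≤ C := fun v hv p =>
    ((fderiv ℝ Φ p).le_opNorm v).trans <| by
      calc _ ≤ C * 1 := by gcongr; exact hC p
        _ = C := mul_one C
  have hlim : ∀ᵐ ω ∂P, Tendsto (fun n => ((S' n).val X ω, (T' n).val X ω)) atTop
      (𝓝 (A ω, B ω)) := by
    filter_upwards [hsae, htae] with ω h1 h2
    exact (h1.comp ht.tendsto_atTop).prodMk_nhds h2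
  have hv1 : ‖((1, 0) : ℝ × ℝ)‖ ≤ 1 := by simp [Prod.norm_def]
  have hv2 : ‖((0, 1) : ℝ × ℝ)‖ ≤ 1 := by simp [Prod.norm_def]
  have hterm : ∀ (v : ℝ × ℝ), ‖v‖ ≤ 1 → ∀ (G : ℕ → Ω → H) (G₀ : Ω → H),
      (∀ n, AEStronglyMeasurable (G n) P) → MemLp G₀ 2 P →
      Tendsto (fun n => eLpNorm (fun ω => G n ω - G₀ ω) 2 P) atTop (𝓝 0) →
      Tendsto (fun n => eLpNorm (fun ω =>
        fderiv ℝ Φ ((S' n).val X ω, (T' n).val X ω) v • G n ω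
          - fderiv ℝ Φ (A ω, B ω) v • G₀ ω) 2 P) atTop (𝓝 0) := by
    intro v hv G G₀ hG hG₀ hGl
    refine tendsto_eLpNorm_smul_sub (C := C)
      (fun n => (hdm v).comp_aestronglyMeasurable (hpn n))
      ((hdm v).comp_aestronglyMeasurable hpair) (fun n ω => hdb v hv _) ?_ hG hG₀ hGl
    filter_upwards [hlim] with ω hω
    exact ((hdm v).tendsto _).comp hω
  have hmS : ∀ n, AEStronglyMeasurable ((S' n).deriv X) P := fun n =>
    ((S' n).memLp_deriv (P := P) hX).1
  have hmT : ∀ n, AEStronglyMeasurable ((T' n).deriv X) P := fun n =>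
    ((T' n).memLp_deriv (P := P) hX).1
  have hbd : ∀ (v : ℝ × ℝ), ‖v‖ ≤ 1 → ∀ G₀ : Ω → H, MemLp G₀ 2 P →
      MemLp (fun ω => fderiv ℝ Φ (A ω, B ω) v • G₀ ω) 2 P := fun v hv G₀ hG₀ =>
    .of_le_mul (c := C) hG₀ (((hdm v).comp_aestronglyMeasurable hpair).smul hG₀.1)
      (ae_of_all _ fun ω => by
        rw [norm_smul]
        gcongr
        exact hdb v hv _)
  refine ⟨?_, (hbd _ hv1 DA hDA2).add (hbd _ hv2 DB hDB2),
    fun n => (S' n).comp₂ (T' n) Φ hΦ, ?_, ?_⟩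
  · have hdom : MemLp (fun ω => ‖A ω‖ + ‖B ω‖) 2 P := hA2.norm.add hB2.norm
    have hdom' : MemLp (fun ω => |Φ 0| + C * (‖A ω‖ + ‖B ω‖)) 2 P :=
      (memLp_const (|Φ 0|)).add (hdom.const_mul C)
    refine hdom'.of_le (hΦc.comp_aestronglyMeasurable hpair) (ae_of_all _ fun ω => ?_)
    have h1 := hlip (A ω, B ω) 0
    have h2 : ‖((A ω, B ω) : ℝ × ℝ) - 0‖ ≤ |A ω| + |B ω| := by
      rw [sub_zero, Prod.norm_def]
      exact max_le_add_of_nonneg (abs_nonneg _) (abs_nonneg _)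
    have h3 : C * ‖((A ω, B ω) : ℝ × ℝ) - 0‖ ≤ C * (|A ω| + |B ω|) := by gcongr
    have h4 := abs_sub_abs_le_abs_sub (Φ (A ω, B ω)) (Φ 0)
    simp only [Real.norm_eq_abs]
    refine le_trans ?_ (le_abs_self _)
    linarith
  · have h1 := ENNReal.Tendsto.const_mul (hS.add hT)
      (Or.inr (ENNReal.ofReal_ne_top (r := C)))
    rw [add_zero, mul_zero] at h1
    refine tendsto_of_tendsto_of_tendsto_of_le_of_le tendsto_const_nhds h1 (fun _ => zero_le)
      fun n => ?_
    have hmA : AEStronglyMeasurable (fun ω => ‖(S' n).val X ω - A ω‖) P :=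
      (((S' n).measurable_val hX).aestronglyMeasurable.sub hA2.1).norm
    have hmB : AEStronglyMeasurable (fun ω => ‖(T' n).val X ω - B ω‖) P :=
      (((T' n).measurable_val hX).aestronglyMeasurable.sub hB2.1).norm
    have h2 := eLpNorm_add_le hmA hmB (p := 2) (by norm_num)
    rw [eLpNorm_norm, eLpNorm_norm] at h2
    refine le_trans ?_ (mul_le_mul_right h2 _)
    refine eLpNorm_le_mul_eLpNorm_of_ae_le_mul (ae_of_all _ fun ω => ?_) 2
    simp only [Cylindrical.comp₂_val, Pi.add_apply, Real.norm_eq_abs]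
    refine (hlip _ _).trans ?_
    gcongr
    refine le_trans ?_ (le_abs_self _)
    rw [Prod.mk_sub_mk, Prod.norm_def]
    exact max_le_add_of_nonneg (abs_nonneg _) (abs_nonneg _)
  · have h1 := (hterm _ hv1 _ DA hmS hDA2 hDS).add (hterm _ hv2 _ DB hmT hDB2 hDT)
    rw [add_zero] at h1
    refine tendsto_of_tendsto_of_tendsto_of_le_of_le tendsto_const_nhds h1 (fun _ => zero_le)
      fun n => ?_
    have hm : ∀ (v : ℝ × ℝ) (G : Ω → H) (G₀ : Ω → H), AEStronglyMeasurable G P →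
        AEStronglyMeasurable G₀ P → AEStronglyMeasurable (fun ω =>
          fderiv ℝ Φ ((S' n).val X ω, (T' n).val X ω) v • G ω
            - fderiv ℝ Φ (A ω, B ω) v • G₀ ω) P := fun v G G₀ hG hG₀ =>
      (((hdm v).comp_aestronglyMeasurable (hpn n)).smul hG).sub
        (((hdm v).comp_aestronglyMeasurable hpair).smul hG₀)
    refine le_trans (le_of_eq ?_) (eLpNorm_add_le (hm (1, 0) _ _ (hmS n) hDA2.1)
      (hm (0, 1) _ _ (hmT n) hDB2.1) (by norm_num))
    congr 1
    funext ω
    simp only [Cylindrical.comp₂_deriv, Pi.add_apply]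
    abel

end

/-! ### The Poincaré inequality on Gaussian space -/

section

variable {Ω H : Type*} [MeasurableSpace Ω] [NormedAddCommGroup H] [InnerProductSpace ℝ H]
  {X : H → Ω → ℝ} {P : Measure Ω}

theorem IsIsonormal.memLp_two (hX : IsIsonormal X P) (φ : H) : MemLp (X φ) 2 P :=
  (hX.gaussian.hasGaussianLaw_eval φ).memLp_two

theorem IsIsonormal.inner_toLp (hX : IsIsonormal X P) (φ ψ : H) :
    inner ℝ ((hX.memLp_two φ).toLp (X φ)) ((hX.memLp_two ψ).toLp (X ψ)) = inner ℝ φ ψ := by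
  rw [L2.inner_def, ← hX.covariance φ ψ]
  refine integral_congr_ae ?_
  filter_upwards [(hX.memLp_two φ).coeFn_toLp, (hX.memLp_two ψ).coeFn_toLp] with ω h1 h2
  rw [h1, h2]
  simp [mul_comm]

/-- An isonormal process is linear, up to null sets. -/
theorem IsIsonormal.sum_smul (hX : IsIsonormal X P) {m : ℕ} (c : Fin m → ℝ) (e : Fin m → H) :
    ∀ᵐ ω ∂P, X (∑ j, c j • e j) ω = ∑ j, c j * X (e j) ω := by
  set W : H → Lp ℝ 2 P := fun φ => (hX.memLp_two φ).toLp (X φ) with hW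
  have hin : ∀ φ ψ, inner ℝ (W φ) (W ψ) = inner ℝ φ ψ := hX.inner_toLp
  have key : inner ℝ (W (∑ j, c j • e j) - ∑ j, c j • W (e j))
      (W (∑ j, c j • e j) - ∑ j, c j • W (e j)) = (0 : ℝ) := by
    set θ := ∑ j, c j • e j with hθ
    set T := ∑ j, c j • W (e j) with hT
    have h1 : ∀ φ, inner ℝ (W φ) T = inner ℝ φ θ := fun φ => by
      simp only [hT, hθ, inner_sum, inner_smul_right, hin]
    have h2 : inner ℝ T T = inner ℝ θ θ := by
      conv_lhs => enter [2]; rw [hT]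
      conv_rhs => enter [2]; rw [hθ]
      simp only [sum_inner, inner_smul_left, h1]
    rw [inner_sub_left, inner_sub_right, inner_sub_right, real_inner_comm (W θ) T, h1, h2, hin]
    ring
  rw [inner_self_eq_zero, sub_eq_zero] at key
  have h1 : ∀ᵐ ω ∂P, ∀ j, W (e j) ω = X (e j) ω :=
    ae_all_iff.2 fun j => (hX.memLp_two (e j)).coeFn_toLp
  have h2 : (∑ j, c j • W (e j) : Lp ℝ 2 P) =ᵐ[P] fun ω => ∑ j, c j * W (e j) ω := by
    have h3 : ∀ᵐ ω ∂P, ∀ j, (c j • W (e j) : Lp ℝ 2 P) ω = c j * W (e j) ω :=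
      ae_all_iff.2 fun j => Lp.coeFn_smul _ _
    filter_upwards [Lp.coeFn_finsetSum Finset.univ fun j => c j • W (e j), h3] with ω h4 h5
    rw [h4, Finset.sum_apply]
    exact Finset.sum_congr rfl fun j _ => h5 j
  filter_upwards [(hX.memLp_two (∑ j, c j • e j)).coeFn_toLp, h1, h2] with ω e1 e2 e3
  rw [← e1]
  change W _ ω = _
  rw [key, e3]
  simp only [e2]

/-- The law of `(X(e₁), …, X(eₘ))` for orthonormal `e₁, …, eₘ` is standard Gaussian. -/
theorem IsIsonormal.map_orthonormal (hX : IsIsonormal X P) {m : ℕ} {e : Fin m → H}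
    (he : Orthonormal ℝ e) : P.map (fun ω j => X (e j) ω) = stdGauss m := by
  classical
  have := hX.gaussian.isProbabilityMeasure
  have hlaw : HasGaussianLaw (fun ω j => X (e j) ω) P :=
    (hX.gaussian.hasGaussianLaw (Finset.univ.image e)).map
      (ContinuousLinearMap.pi fun j => ContinuousLinearMap.proj
        (⟨e j, Finset.mem_image_of_mem _ (Finset.mem_univ j)⟩ : Finset.univ.image e))
  have hcov : ∀ φ ψ, cov[X φ, X ψ; P] = inner ℝ φ ψ := fun φ ψ => by
    rw [covariance_eq_sub (hX.memLp_two φ) (hX.memLp_two ψ), hX.centered, zero_mul, sub_zero,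
      ← hX.covariance]
    rfl
  have hind : iIndepFun (fun j => X (e j)) P :=
    hlaw.iIndepFun_of_covariance_eq_zero fun i j hij => by
      rw [hcov, he.2 hij]
  rw [(iIndepFun_iff_map_fun_eq_pi_map fun j => (hX.measurable (e j)).aemeasurable).1 hind]
  congr 1
  funext j
  rw [(hX.gaussian.hasGaussianLaw_eval (e j)).map_eq_gaussianReal, hX.centered,
    ← covariance_self (hX.measurable _).aemeasurable, hcov, real_inner_self_eq_norm_sq, he.1 j]
  simp

theorem Cylindrical.fderiv_apply_eq (S : Cylindrical H) (x v : Fin S.n → ℝ) :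
    fderiv ℝ S.f x v = ∑ i, v i * fderiv ℝ S.f x (Pi.single i 1) := by
  conv_lhs => rw [pi_eq_sum_univ' v]
  simp [map_sum]

/-- The Poincaré inequality for cylindrical random variables, by a change of variables to an
orthonormal basis of the span of `φ₁, …, φₙ`. -/
theorem Cylindrical.poincare (hX : IsIsonormal X P) (S : Cylindrical H) :
    ∫ ω, S.val X ω ^ 2 ∂P ≤ (∫ ω, S.val X ω ∂P) ^ 2 + ∫ ω, ‖S.deriv X ω‖ ^ 2 ∂P := by
  have := hX.gaussian.isProbabilityMeasure
  set V := Submodule.span ℝ (Set.range S.φ) with hV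
  have hVfin : FiniteDimensional ℝ V := FiniteDimensional.span_of_finite ℝ (Set.finite_range _)
  set m := Module.finrank ℝ V with hm
  set b := stdOrthonormalBasis ℝ V with hb
  set e : Fin m → H := fun j => (b j : H) with he
  have heo : Orthonormal ℝ e := b.orthonormal.comp_linearIsometry V.subtypeₗᵢ
  have hexp : ∀ i, S.φ i = ∑ j, inner ℝ (e j) (S.φ i) • e j := fun i => by
    have hmem : S.φ i ∈ V := Submodule.subset_span ⟨i, rfl⟩
    have := congrArg (fun v : V => (v : H)) (b.sum_repr' ⟨S.φ i, hmem⟩)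
    simpa using this.symm
  set Y : Ω → Fin m → ℝ := fun ω j => X (e j) ω with hY
  have hYm : Measurable Y := measurable_pi_lambda _ fun j => hX.measurable _
  set L : (Fin m → ℝ) →L[ℝ] (Fin S.n → ℝ) := ContinuousLinearMap.pi fun i =>
    ∑ j, (inner ℝ (e j) (S.φ i) : ℝ) • ContinuousLinearMap.proj j with hL
  have hLY : ∀ᵐ ω ∂P, S.vec X ω = L (Y ω) := by
    have : ∀ i, ∀ᵐ ω ∂P, X (S.φ i) ω = ∑ j, inner ℝ (e j) (S.φ i) * X (e j) ω := fun i => by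
      have := hX.sum_smul (fun j => inner ℝ (e j) (S.φ i)) e
      rwa [← hexp i] at this
    filter_upwards [ae_all_iff.2 this] with ω hω
    funext i
    simpa [hL, Cylindrical.vec] using hω i
  set g : (Fin m → ℝ) → ℝ := fun y => S.f (L y) with hg
  have hgs : SmoothBounded g := S.smoothBounded.comp_clm L
  have hgc : Continuous g := hgs.1.continuous
  have hgdc : Continuous (fderiv ℝ g) := hgs.1.continuous_fderiv (by simp)
  obtain ⟨C0, hC0⟩ := hgs.2 0
  obtain ⟨C1, hC1⟩ := hgs.2 1
  have hp := poincare_stdGauss m (g := g) (C := max C0 C1) (hgs.1.of_le (by simp))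
    (fun x => by
      have := hC0 x
      rw [norm_iteratedFDeriv_zero] at this
      exact this.trans (le_max_left _ _))
    (fun x => by
      have := hC1 x
      rw [norm_iteratedFDeriv_one] at this
      exact this.trans (le_max_right _ _))
  rw [← hX.map_orthonormal heo, integral_map hYm.aemeasurable (by fun_prop),
    integral_map hYm.aemeasurable (by fun_prop), integral_map hYm.aemeasurable (by fun_prop)] at hp
  have hval : ∀ᵐ ω ∂P, S.val X ω = g (Y ω) := hLY.mono fun ω h => by
    simp only [hg, ← h, Cylindrical.val]
  have hder : ∀ᵐ ω ∂P, ∑ j, (fderiv ℝ g (Y ω) (Pi.single j 1)) ^ 2 ≤ ‖S.deriv X ω‖ ^ 2 :=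
    hLY.mono fun ω h => by
      have h1 : ∀ j, fderiv ℝ g (Y ω) (Pi.single j 1) = inner ℝ (e j) (S.deriv X ω) := fun j => by
        have h2 : HasFDerivAt g ((fderiv ℝ S.f (L (Y ω))).comp L) (Y ω) :=
          (S.smooth.differentiable (by simp) _).hasFDerivAt.comp (Y ω) L.hasFDerivAt
        rw [h2.fderiv, ContinuousLinearMap.comp_apply, S.fderiv_apply_eq, ← h,
          Cylindrical.deriv, inner_sum]
        refine Finset.sum_congr rfl fun i _ => ?_
        rw [inner_smul_right, mul_comm]
        congr 1
        simp [hL, Pi.single_apply]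
      simp only [h1]
      have := heo.sum_inner_products_le (x := S.deriv X ω) (s := Finset.univ)
      simpa using this
  have hYP : ∫ ω, ∑ j, (fderiv ℝ g (Y ω) (Pi.single j 1)) ^ 2 ∂P
      ≤ ∫ ω, ‖S.deriv X ω‖ ^ 2 ∂P :=
    integral_mono_of_nonneg (ae_of_all _ fun ω => Finset.sum_nonneg fun _ _ => sq_nonneg _)
      (S.memLp_deriv hX.measurable).integrable_norm_pow' hder
  rw [integral_congr_ae (f := fun ω => S.val X ω ^ 2) (g := fun ω => g (Y ω) ^ 2)
    (hval.mono fun ω h => by simp only [h]), integral_congr_ae hval]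
  linarith

theorem tendsto_integral_norm_sq {E : Type*} [NormedAddCommGroup E] [InnerProductSpace ℝ E]
    {f : ℕ → Ω → E} {f₀ : Ω → E} (hf : ∀ n, MemLp (f n) 2 P) (hf₀ : MemLp f₀ 2 P)
    (h : Tendsto (fun n => eLpNorm (fun ω => f n ω - f₀ ω) 2 P) atTop (𝓝 0)) :
    Tendsto (fun n => ∫ ω, ‖f n ω‖ ^ 2 ∂P) atTop (𝓝 (∫ ω, ‖f₀ ω‖ ^ 2 ∂P)) := by
  have e : ∀ {g : Ω → E} (hg : MemLp g 2 P), ∫ ω, ‖g ω‖ ^ 2 ∂P = ‖hg.toLp g‖ ^ 2 := by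
    intro g hg
    rw [← real_inner_self_eq_norm_sq, L2.inner_def]
    refine integral_congr_ae (hg.coeFn_toLp.mono fun ω h => ?_)
    simp only [h, real_inner_self_eq_norm_sq]
  have h1 := ((Lp.tendsto_Lp_iff_tendsto_eLpNorm'' f hf f₀ hf₀).2 h).norm.pow 2
  rw [e hf₀]
  simpa only [e (hf _)] using h1

theorem Cylindrical.memLp_val [IsFiniteMeasure P] (S : Cylindrical H)
    (hX : ∀ φ, Measurable (X φ)) : MemLp (S.val X) 2 P := by
  obtain ⟨C, hC⟩ := S.bounded 0
  refine .of_bound (S.measurable_val hX).aestronglyMeasurable C (ae_of_all _ fun ω => ?_)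
  have := hC (S.vec X ω)
  rwa [norm_iteratedFDeriv_zero] at this

/-- The Poincaré inequality on Gaussian space: `Var A ≤ E‖DA‖²` for `A ∈ 𝔻^{1,2}`. -/
theorem HasDeriv.poincare (hX : IsIsonormal X P) {A : Ω → ℝ} {DA : Ω → H}
    (h : HasDeriv X P A DA) :
    ∫ ω, A ω ^ 2 ∂P ≤ (∫ ω, A ω ∂P) ^ 2 + ∫ ω, ‖DA ω‖ ^ 2 ∂P := by
  have := hX.gaussian.isProbabilityMeasure
  obtain ⟨hA, hDA, S, hS, hDS⟩ := h
  have hm := fun n => (S n).memLp_val (P := P) hX.measurable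
  have l1 := tendsto_integral_norm_sq hm hA hS
  have l2 := tendsto_integral_norm_sq (fun n => (S n).memLp_deriv (P := P) hX.measurable) hDA hDS
  have l3 : Tendsto (fun n => ∫ ω, (S n).val X ω ∂P) atTop (𝓝 (∫ ω, A ω ∂P)) := by
    refine tendsto_integral_of_L1' A (hA.integrable one_le_two).1
      (Eventually.of_forall fun n => (hm n).integrable one_le_two) ?_
    refine tendsto_of_tendsto_of_tendsto_of_le_of_le tendsto_const_nhds hS (fun _ => zero_le)
      fun n => ?_
    exact eLpNorm_le_eLpNorm_of_exponent_le one_le_two ((hm n).sub hA).1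
  simp only [Real.norm_eq_abs, sq_abs] at l1
  exact le_of_tendsto_of_tendsto' l1 ((l3.pow 2).add l2) fun n => (S n).poincare hX

end

/-! ### Total variation distance and smooth test functions -/

open scoped Manifold ContDiff in
/-- The total variation distance is controlled by smooth test functions with values in `[0, 1]`:
by regularity and Urysohn's lemma these approximate indicators of Borel sets. -/
theorem dTV_le_of_forall_contDiff {μ ν : Measure ℝ} [IsProbabilityMeasure μ]
    [IsProbabilityMeasure ν] {K : ℝ}
    (h : ∀ f : ℝ → ℝ, ContDiff ℝ ((⊤ : ℕ∞) : WithTop ℕ∞) f → (∀ x, f x ∈ Set.Icc 0 1) →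
      |∫ x, f x ∂μ - ∫ x, f x ∂ν| ≤ K) : dTV μ ν ≤ K := by
  have : Nonempty {B : Set ℝ // MeasurableSet B} := ⟨⟨∅, MeasurableSet.empty⟩⟩
  refine ciSup_le fun ⟨B, hB⟩ => le_of_forall_pos_le_add fun ε hε => ?_
  have hε2 : ENNReal.ofReal (ε / 2) ≠ 0 := by simpa using hε
  obtain ⟨U, hBU, hU, -, hUε⟩ := hB.exists_isOpen_sdiff_lt (μ := μ + ν) (by simp) hε2
  obtain ⟨C, hCB, hC, hCε⟩ := hB.exists_isClosed_sdiff_lt (μ := μ + ν) (by simp) hε2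
  have hsub : ∀ (s t : Set ℝ) (ρ : Measure ℝ) [IsFiniteMeasure ρ], MeasurableSet s →
      MeasurableSet t → s ⊆ t → ρ ≤ μ + ν → (μ + ν) (t \ s) < ENNReal.ofReal (ε / 2) →
      ρ.real t ≤ ρ.real s + ε / 2 := by
    intro s t ρ _ hs ht hst hρ hlt
    have h1 := measureReal_sdiff (μ := ρ) hst hs
    have h2 : ρ.real (t \ s) ≤ ε / 2 :=
      ENNReal.toReal_le_of_le_ofReal (by positivity) ((hρ _).trans hlt.le)
    linarith
  obtain ⟨f, hf0, hf1, hf01⟩ := exists_contMDiffMap_zero_one_of_isClosed (n := (⊤ : ℕ∞)) 𝓘(ℝ)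
    hU.isClosed_compl hC
    (Set.disjoint_left.2 fun x hx hxC => hx (hBU (hCB hxC)))
  have hfs : ContDiff ℝ ((⊤ : ℕ∞) : WithTop ℕ∞) f := f.contMDiff.contDiff
  have hint : ∀ (ρ : Measure ℝ) [IsProbabilityMeasure ρ], ρ ≤ μ + ν →
      |∫ x, f x ∂ρ - ρ.real B| ≤ ε / 2 := by
    intro ρ _ hρ
    have hfi : Integrable (fun x => f x) ρ := .of_bound hfs.continuous.aestronglyMeasurable 1
      (ae_of_all _ fun x => by
        rw [Real.norm_eq_abs, abs_le]
        have := hf01 x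
        constructor <;> linarith [this.1, this.2])
    have h1 : ρ.real C ≤ ∫ x, f x ∂ρ := by
      rw [← integral_indicator_one hC.measurableSet]
      refine integral_mono ((integrable_const 1).indicator hC.measurableSet) hfi fun x => ?_
      by_cases hx : x ∈ C
      · simp [hx, hf1 hx]
      · simpa [hx] using (hf01 x).1
    have h2 : ∫ x, f x ∂ρ ≤ ρ.real U := by
      rw [← integral_indicator_one hU.measurableSet]
      refine integral_mono hfi ((integrable_const 1).indicator hU.measurableSet) fun x => ?_
      by_cases hx : x ∈ U
      · simpa [hx] using (hf01 x).2
      · simp [hx, hf0 (show x ∈ Uᶜ from hx)]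
    have h3 := hsub B U ρ hB hU.measurableSet hBU hρ hUε
    have h4 := hsub C B ρ hC.measurableSet hB hCB hρ hCε
    rw [abs_le]
    constructor <;> linarith
  have h1 := hint μ (Measure.le_add_right le_rfl)
  have h2 := hint ν (Measure.le_add_left le_rfl)
  have h3 := h f hfs hf01
  rw [abs_le] at *
  constructor <;> linarith [h1.1, h1.2, h2.1, h2.2, h3.1, h3.2]

/-! ### Integration by parts against the divergence -/

/-- The smooth truncation `x ↦ N sin(x / N)`, with `N = n + 1`, of the identity. -/
noncomputable def sinTrunc (n : ℕ) (x : ℝ) : ℝ := (n + 1) * Real.sin (x / (n + 1))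

theorem contDiff_sinTrunc (n : ℕ) : ContDiff ℝ ((⊤ : ℕ∞) : WithTop ℕ∞) (sinTrunc n) := by
  unfold sinTrunc
  fun_prop

theorem hasDerivAt_sinTrunc (n : ℕ) (x : ℝ) :
    HasDerivAt (sinTrunc n) (Real.cos (x / (n + 1))) x := by
  have hn : (n + 1 : ℝ) ≠ 0 := by positivity
  refine ((((hasDerivAt_id x).div_const (n + 1 : ℝ)).sin).const_mul (n + 1 : ℝ)).congr_deriv ?_
  simp
  field_simp

theorem abs_sinTrunc_le (n : ℕ) (x : ℝ) : |sinTrunc n x| ≤ n + 1 := by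
  rw [sinTrunc, abs_mul, abs_of_pos (by positivity : (0 : ℝ) < n + 1)]
  exact mul_le_of_le_one_right (by positivity) (Real.abs_sin_le_one _)

theorem abs_sinTrunc_le_abs (n : ℕ) (x : ℝ) : |sinTrunc n x| ≤ |x| := by
  have hn : (0 : ℝ) < n + 1 := by positivity
  rw [sinTrunc, abs_mul, abs_of_pos hn]
  calc _ ≤ (n + 1 : ℝ) * |x / (n + 1)| := mul_le_mul_of_nonneg_left Real.abs_sin_le_abs hn.le
    _ = |x| := by rw [abs_div, abs_of_pos hn]; field_simp

theorem tendsto_div_add_one (x : ℝ) : Tendsto (fun n : ℕ => x / (n + 1 : ℝ)) atTop (𝓝 0) := by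
  simpa [div_eq_mul_inv] using (tendsto_one_div_add_atTop_nhds_zero_nat (𝕜 := ℝ)).const_mul x

theorem tendsto_sinTrunc (x : ℝ) : Tendsto (fun n => sinTrunc n x) atTop (𝓝 x) := by
  have h : ∀ n : ℕ, sinTrunc n x = x * Real.sinc (x / (n + 1)) := fun n => by
    have hn : (n + 1 : ℝ) ≠ 0 := by positivity
    rcases eq_or_ne x 0 with rfl | hx
    · simp [sinTrunc]
    · rw [sinTrunc, Real.sinc_of_ne_zero (div_ne_zero hx hn)]
      field_simp
  simp only [h]
  have := (Real.continuous_sinc.tendsto 0).comp (tendsto_div_add_one x)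
  simpa using this.const_mul x

theorem tendsto_cos_div (x : ℝ) :
    Tendsto (fun n : ℕ => Real.cos (x / (n + 1))) atTop (𝓝 1) := by
  have := (Real.continuous_cos.tendsto 0).comp (tendsto_div_add_one x)
  rwa [Real.cos_zero] at this

section

variable {Ω H : Type*} [MeasurableSpace Ω] [NormedAddCommGroup H] [InnerProductSpace ℝ H]
  {X : H → Ω → ℝ} {P : Measure Ω} {u : Ω → H} {F M : Ω → ℝ} {DF DM : Ω → H}

theorem integrable_inner_of_memLp {f g : Ω → H} (hf : MemLp f 2 P) (hg : MemLp g 2 P) :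
    Integrable (fun ω => (inner ℝ (f ω) (g ω) : ℝ)) P := by
  refine (hf.norm.integrable_mul hg.norm).mono (hf.1.inner hg.1) (ae_of_all _ fun ω => ?_)
  simp only [Pi.mul_apply, norm_mul, norm_norm]
  exact norm_inner_le_norm _ _

theorem fderiv_mul_prod {φ T : ℝ → ℝ} {φ' T' : ℝ → ℝ} (hφ : ∀ x, HasDerivAt φ (φ' x) x)
    (hT : ∀ x, HasDerivAt T (T' x) x) (p v : ℝ × ℝ) :
    fderiv ℝ (fun p : ℝ × ℝ => φ p.1 * T p.2) p v
      = φ' p.1 * T p.2 * v.1 + φ p.1 * T' p.2 * v.2 := by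
  have h1 : HasFDerivAt (fun p : ℝ × ℝ => φ p.1) _ p :=
    (hφ p.1).comp_hasFDerivAt p (hasFDerivAt_fst (𝕜 := ℝ))
  have h2 : HasFDerivAt (fun p : ℝ × ℝ => T p.2) _ p :=
    (hT p.2).comp_hasFDerivAt p (hasFDerivAt_snd (𝕜 := ℝ))
  rw [(h1.fun_mul h2).fderiv]
  simp
  ring

/-- The duality between `D` and `δ` applied to `φ(F) T(M)`, whose gradient is bounded when `φ' T` and
`φ T'` are, so that the chain rule applies to it. -/
theorem IsDivergence.integral_mul_comp_of_bounded [IsFiniteMeasure P]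
    (hX : ∀ φ, Measurable (X φ)) (hF : IsDivergence X P u F) (hDF : HasDeriv X P F DF)
    (hDM : HasDeriv X P M DM) {φ T φ' T' : ℝ → ℝ} {C : ℝ}
    (hφs : ContDiff ℝ ((⊤ : ℕ∞) : WithTop ℕ∞) φ) (hTs : ContDiff ℝ ((⊤ : ℕ∞) : WithTop ℕ∞) T)
    (hφ : ∀ x, HasDerivAt φ (φ' x) x) (hT : ∀ x, HasDerivAt T (T' x) x)
    (h1 : ∀ x y, |φ' x * T y| ≤ C) (h2 : ∀ x y, |φ x * T' y| ≤ C) :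
    ∫ ω, φ (F ω) * T (M ω) * F ω ∂P
      = ∫ ω, (φ' (F ω) * T (M ω) * inner ℝ (u ω) (DF ω)
        + φ (F ω) * T' (M ω) * inner ℝ (u ω) (DM ω)) ∂P := by
  have hs : ContDiff ℝ ((⊤ : ℕ∞) : WithTop ℕ∞) fun p : ℝ × ℝ => φ p.1 * T p.2 := by fun_prop
  have hC0 : 0 ≤ C := (abs_nonneg _).trans (h1 0 0)
  have h := hDF.comp₂ hX hDM hs (C := 2 * C) fun p => by
    refine ContinuousLinearMap.opNorm_le_bound _ (by positivity) fun v => ?_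
    rw [fderiv_mul_prod hφ hT, Real.norm_eq_abs]
    refine (abs_add_le _ _).trans ?_
    rw [abs_mul, abs_mul _ v.2]
    have e1 : |v.1| ≤ ‖v‖ := norm_fst_le v
    have e2 : |v.2| ≤ ‖v‖ := norm_snd_le v
    calc _ ≤ C * ‖v‖ + C * ‖v‖ := by
          gcongr
          · exact h1 _ _
          · exact h2 _ _
      _ = _ := by ring
  rw [hF.2 _ _ h]
  refine integral_congr_ae (ae_of_all _ fun ω => ?_)
  simp only [fderiv_mul_prod hφ hT, real_inner_comm (u ω), inner_add_right, inner_smul_right]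
  ring

/-- `E[F g(F)] = E[g'(F) ⟨u, DF⟩]` for smooth `g` with bounded derivative. -/
theorem IsDivergence.integral_comp_mul [IsFiniteMeasure P]
    (hX : ∀ φ, Measurable (X φ)) (hF : IsDivergence X P u F) (hDF : HasDeriv X P F DF)
    {g g' : ℝ → ℝ} {C : ℝ} (hgs : ContDiff ℝ ((⊤ : ℕ∞) : WithTop ℕ∞) g)
    (hg : ∀ x, HasDerivAt g (g' x) x) (hC : ∀ x, |g' x| ≤ C) :
    ∫ ω, g (F ω) * F ω ∂P = ∫ ω, g' (F ω) * inner ℝ (u ω) (DF ω) ∂P := by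
  have h := hF.integral_mul_comp_of_bounded hX hDF hDF (T := fun _ => 1) (T' := fun _ => 0)
    (C := C) hgs contDiff_const hg (fun x => hasDerivAt_const x 1)
    (fun x _ => by simpa using hC x) (fun x _ => by simpa using (abs_nonneg _).trans (hC 0))
  simpa using h

theorem abs_mul_mul_le {a A x y : ℝ} (h : |a| ≤ A) : |a * (x * y)| ≤ A * |x * y| := by
  rw [abs_mul]
  gcongr

theorem abs_mul_le_abs_mul {x x' : ℝ} (h : |x| ≤ |x'|) (y : ℝ) : |x * y| ≤ |x' * y| := by
  rw [abs_mul, abs_mul]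
  exact mul_le_mul_of_nonneg_right h (abs_nonneg y)

/-- Integration by parts with an unbounded factor `M ∈ 𝔻^{1,2}`, by truncation of `M`. -/
theorem IsDivergence.integral_comp_mul_mul [IsFiniteMeasure P]
    (hX : ∀ φ, Measurable (X φ)) (hu : MemLp u 2 P) (hF : IsDivergence X P u F)
    (hDF : HasDeriv X P F DF) (hDM : HasDeriv X P M DM)
    (hd : MemLp (fun ω => (inner ℝ (u ω) (DF ω) : ℝ)) 2 P) {φ φ' : ℝ → ℝ} {a : ℝ}
    (hφs : ContDiff ℝ ((⊤ : ℕ∞) : WithTop ℕ∞) φ) (hφ : ∀ x, HasDerivAt φ (φ' x) x)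
    (ha : ∀ x, |φ x| ≤ a) (ha' : ∀ x, |φ' x| ≤ a) :
    ∫ ω, φ (F ω) * (M ω * F ω) ∂P
      = ∫ ω, (φ' (F ω) * (M ω * inner ℝ (u ω) (DF ω)) + φ (F ω) * inner ℝ (u ω) (DM ω)) ∂P := by
  have hFm := hF.1.1
  have hMm := hDM.1.1
  have hφc : Continuous φ := hφs.continuous
  have hφ'c : Continuous φ' := by
    rw [← funext fun x => (hφ x).deriv]
    exact hφs.continuous_deriv (by simp)
  have he := integrable_inner_of_memLp hu hDM.2.1
  have hMF : Integrable (fun ω => M ω * F ω) P := hDM.1.integrable_mul hF.1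
  have hMd : Integrable (fun ω => M ω * inner ℝ (u ω) (DF ω)) P := hDM.1.integrable_mul hd
  have ha0 : 0 ≤ a := (abs_nonneg _).trans (ha 0)
  have heq : ∀ n : ℕ, ∫ ω, φ (F ω) * sinTrunc n (M ω) * F ω ∂P
      = ∫ ω, (φ' (F ω) * sinTrunc n (M ω) * inner ℝ (u ω) (DF ω)
        + φ (F ω) * Real.cos (M ω / (n + 1)) * inner ℝ (u ω) (DM ω)) ∂P := fun n =>
    hF.integral_mul_comp_of_bounded hX hDF hDM (C := a * (n + 1)) hφs (contDiff_sinTrunc n) hφ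
      (hasDerivAt_sinTrunc n) (fun x y => abs_mul_le (ha' x) (abs_sinTrunc_le n y)) fun x y => by
        refine (abs_mul_le (ha x) (Real.abs_cos_le_one _)).trans ?_
        gcongr
        linarith [(Nat.cast_nonneg n : (0 : ℝ) ≤ n)]
  have hTm : ∀ n, AEStronglyMeasurable (fun ω => sinTrunc n (M ω)) P := fun n =>
    (contDiff_sinTrunc n).continuous.comp_aestronglyMeasurable hMm
  have hcm : ∀ n : ℕ, AEStronglyMeasurable (fun ω => Real.cos (M ω / (n + 1))) P := fun n =>
    (by fun_prop : Continuous fun x : ℝ => Real.cos (x / (n + 1))).comp_aestronglyMeasurable hMm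
  have hφm : AEStronglyMeasurable (fun ω => φ (F ω)) P := hφc.comp_aestronglyMeasurable hFm
  have hφ'm : AEStronglyMeasurable (fun ω => φ' (F ω)) P := hφ'c.comp_aestronglyMeasurable hFm
  have l1 : Tendsto (fun n => ∫ ω, φ (F ω) * sinTrunc n (M ω) * F ω ∂P) atTop
      (𝓝 (∫ ω, φ (F ω) * (M ω * F ω) ∂P)) := by
    refine tendsto_integral_of_dominated_convergence (fun ω => a * |M ω * F ω|)
      (fun n => (hφm.mul (hTm n)).mul hFm) (hMF.abs.const_mul a)
      (fun n => ae_of_all _ fun ω => ?_) (ae_of_all _ fun ω => ?_)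
    · rw [Real.norm_eq_abs, mul_assoc]
      refine (abs_mul_mul_le (ha _)).trans ?_
      exact mul_le_mul_of_nonneg_left (abs_mul_le_abs_mul (abs_sinTrunc_le_abs _ _) _) ha0
    · rw [← mul_assoc]
      exact ((tendsto_sinTrunc _).const_mul _).mul_const _
  have l2 : Tendsto (fun n : ℕ => ∫ ω, (φ' (F ω) * sinTrunc n (M ω) * inner ℝ (u ω) (DF ω)
        + φ (F ω) * Real.cos (M ω / (n + 1)) * inner ℝ (u ω) (DM ω)) ∂P) atTop
      (𝓝 (∫ ω, (φ' (F ω) * (M ω * inner ℝ (u ω) (DF ω)) + φ (F ω) * inner ℝ (u ω) (DM ω)) ∂P)) := by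
    refine tendsto_integral_of_dominated_convergence
      (fun ω => a * |M ω * inner ℝ (u ω) (DF ω)| + a * |inner ℝ (u ω) (DM ω)|)
      (fun n => ((hφ'm.mul (hTm n)).mul hd.1).add ((hφm.mul (hcm n)).mul he.1))
      ((hMd.abs.const_mul a).add (he.abs.const_mul a))
      (fun n => ae_of_all _ fun ω => ?_) (ae_of_all _ fun ω => ?_)
    · rw [Real.norm_eq_abs]
      refine (abs_add_le _ _).trans (add_le_add ?_ ?_)
      · rw [mul_assoc]
        refine (abs_mul_mul_le (ha' _)).trans ?_
        exact mul_le_mul_of_nonneg_left (abs_mul_le_abs_mul (abs_sinTrunc_le_abs _ _) _) ha0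
      · rw [mul_assoc]
        refine (abs_mul_mul_le (ha _)).trans ?_
        rw [abs_mul]
        gcongr
        exact mul_le_of_le_one_left (abs_nonneg _) (Real.abs_cos_le_one _)
    · refine Tendsto.add ?_ ?_
      · rw [← mul_assoc]
        exact ((tendsto_sinTrunc _).const_mul _).mul_const _
      · have := ((tendsto_cos_div (M ω)).const_mul (φ (F ω))).mul_const (inner ℝ (u ω) (DM ω))
        rwa [mul_one] at this
  exact tendsto_nhds_unique l1 (by simpa only [heq] using l2)

end

/-! ### The third moment of a divergence -/

theorem hasDerivAt_sqrt_one_add_sinTrunc_sq (n : ℕ) (x : ℝ) :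
    HasDerivAt (fun x => √(1 + sinTrunc n x ^ 2))
      (sinTrunc n x * Real.cos (x / (n + 1)) / √(1 + sinTrunc n x ^ 2)) x := by
  have h := (((hasDerivAt_sinTrunc n x).pow 2).const_add 1).sqrt
    (by simp only [Pi.pow_apply]; positivity)
  refine h.congr_deriv ?_
  simp only [Pi.pow_apply]
  field_simp
  norm_num
  ring

theorem contDiff_sqrt_one_add_sinTrunc_sq (n : ℕ) :
    ContDiff ℝ ((⊤ : ℕ∞) : WithTop ℕ∞) fun x => √(1 + sinTrunc n x ^ 2) :=
  (contDiff_const.add ((contDiff_sinTrunc n).pow 2)).sqrt fun x => by positivity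

theorem abs_le_sqrt_one_add_sq (t : ℝ) : |t| ≤ √(1 + t ^ 2) :=
  Real.abs_le_sqrt (by linarith)

theorem sqrt_one_add_sq_le (t : ℝ) : √(1 + t ^ 2) ≤ 1 + |t| := by
  rw [Real.sqrt_le_left (by positivity)]
  nlinarith [abs_nonneg t, sq_abs t]

section

variable {Ω H : Type*} [MeasurableSpace Ω] [NormedAddCommGroup H] [InnerProductSpace ℝ H]
  {X : H → Ω → ℝ} {P : Measure Ω} {u : Ω → H} {F : Ω → ℝ} {DF : Ω → H}

/-- `F = δ(u)` has a finite third absolute moment if `D_u F ∈ L²`. Integration by parts bounds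
`E[F² φₙ(F)]` uniformly in `n` for `φₙ = √(1 + (N sin(· / N))²)`, and Fatou's lemma applies. -/
theorem IsDivergence.integrable_pow_three [IsFiniteMeasure P]
    (hX : ∀ φ, Measurable (X φ)) (hu : MemLp u 2 P) (hF : IsDivergence X P u F)
    (hDF : HasDeriv X P F DF) (hd : MemLp (fun ω => (inner ℝ (u ω) (DF ω) : ℝ)) 2 P) :
    Integrable (fun ω => F ω ^ 3) P := by
  have hFm := hF.1.1
  have hF2 : Integrable (fun ω => F ω * F ω) P := hF.1.integrable_mul hF.1
  have hFd : Integrable (fun ω => F ω * inner ℝ (u ω) (DF ω)) P := hF.1.integrable_mul hd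
  have hd1 := integrable_inner_of_memLp hu hDF.2.1
  set φ : ℕ → ℝ → ℝ := fun n x => √(1 + sinTrunc n x ^ 2) with hφ
  have hφc : ∀ n, Continuous (φ n) := fun n => (contDiff_sqrt_one_add_sinTrunc_sq n).continuous
  have hφ0 : ∀ n x, 0 ≤ φ n x := fun n x => Real.sqrt_nonneg _
  have hφa : ∀ n x, |φ n x| ≤ 1 + (n + 1) := fun n x => by
    rw [abs_of_nonneg (hφ0 n x)]
    exact (sqrt_one_add_sq_le _).trans (by gcongr; exact abs_sinTrunc_le n x)
  have hφ1 : ∀ n x, φ n x ≤ 1 + |x| := fun n x =>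
    (sqrt_one_add_sq_le _).trans (add_le_add_right (abs_sinTrunc_le_abs n x) 1)
  have hφ' : ∀ n x, |sinTrunc n x * Real.cos (x / (n + 1)) / √(1 + sinTrunc n x ^ 2)| ≤ 1 :=
    fun n x => by
      have hp : 0 < √(1 + sinTrunc n x ^ 2) := by positivity
      rw [abs_div, abs_of_pos hp, div_le_one hp, abs_mul]
      exact (mul_le_of_le_one_right (abs_nonneg _) (Real.abs_cos_le_one _)).trans
        (abs_le_sqrt_one_add_sq _)
  have hi : ∀ n, Integrable (fun ω => φ n (F ω) * (F ω * F ω)) P := fun n =>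
    hF2.bdd_mul ((hφc n).comp_aestronglyMeasurable hFm) (ae_of_all _ fun ω => hφa n _)
  have hK : Integrable (fun ω => |F ω * inner ℝ (u ω) (DF ω)|
      + (|(inner ℝ (u ω) (DF ω) : ℝ)| + |F ω * inner ℝ (u ω) (DF ω)|)) P :=
    hFd.abs.add (hd1.abs.add hFd.abs)
  set K := ∫ ω, (|F ω * inner ℝ (u ω) (DF ω)|
      + (|(inner ℝ (u ω) (DF ω) : ℝ)| + |F ω * inner ℝ (u ω) (DF ω)|)) ∂P
  have hbound : ∀ n, ∫ ω, φ n (F ω) * (F ω * F ω) ∂P ≤ K := fun n => by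
    rw [hF.integral_comp_mul_mul hX hu hDF hDF hd (a := 1 + (n + 1))
      (contDiff_sqrt_one_add_sinTrunc_sq n) (hasDerivAt_sqrt_one_add_sinTrunc_sq n) (hφa n)
      (fun x => (hφ' n x).trans (by linarith [(Nat.cast_nonneg n : (0 : ℝ) ≤ n)]))]
    refine (le_abs_self _).trans (abs_integral_le_integral_abs.trans ?_)
    refine integral_mono_of_nonneg (ae_of_all _ fun ω => abs_nonneg _) hK
      (ae_of_all _ fun ω => ?_)
    refine (abs_add_le _ _).trans (add_le_add ?_ ?_)
    · rw [abs_mul]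
      exact mul_le_of_le_one_left (abs_nonneg _) (hφ' n _)
    · rw [abs_mul, abs_mul, ← one_add_mul]
      gcongr
      rw [abs_of_nonneg (Real.sqrt_nonneg _)]
      exact hφ1 n _
  have hlim : ∀ᵐ ω ∂P, Tendsto (fun n => φ n (F ω) * (F ω * F ω)) atTop
      (𝓝 (√(1 + F ω ^ 2) * (F ω * F ω))) := ae_of_all _ fun ω =>
    ((((tendsto_sinTrunc (F ω)).pow 2).const_add 1).sqrt).mul_const _
  have hle : ∀ n, ∫⁻ ω, ‖φ n (F ω) * (F ω * F ω)‖ₑ ∂P ≤ ENNReal.ofReal K := fun n => by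
    rw [← ofReal_integral_norm_eq_lintegral_enorm (hi n)]
    apply ENNReal.ofReal_le_ofReal
    refine le_trans (le_of_eq ?_) (hbound n)
    refine integral_congr_ae (ae_of_all _ fun ω => ?_)
    exact Real.norm_of_nonneg (mul_nonneg (hφ0 n _) (mul_self_nonneg _))
  have hfin : ∫⁻ ω, ‖√(1 + F ω ^ 2) * (F ω * F ω)‖ₑ ∂P < ∞ :=
    calc ∫⁻ ω, ‖√(1 + F ω ^ 2) * (F ω * F ω)‖ₑ ∂P
        = ∫⁻ ω, liminf (fun n => ‖φ n (F ω) * (F ω * F ω)‖ₑ) atTop ∂P :=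
          lintegral_congr_ae (hlim.mono fun ω h => h.enorm.liminf_eq.symm)
      _ ≤ liminf (fun n => ∫⁻ ω, ‖φ n (F ω) * (F ω * F ω)‖ₑ ∂P) atTop :=
          lintegral_liminf_le' fun n => (hi n).1.enorm
      _ ≤ ENNReal.ofReal K := liminf_le_of_le (by isBoundedDefault) fun b hb => by
          obtain ⟨n, hn⟩ := hb.exists
          exact hn.trans (hle n)
      _ < ∞ := ENNReal.ofReal_lt_top
  have hdom : Integrable (fun ω => √(1 + F ω ^ 2) * (F ω * F ω)) P :=
    ⟨(by fun_prop : Continuous fun x : ℝ => √(1 + x ^ 2) * (x * x)).comp_aestronglyMeasurable hFm,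
      hfin⟩
  refine hdom.mono (hFm.pow 3) (ae_of_all _ fun ω => ?_)
  rw [Real.norm_eq_abs, Real.norm_eq_abs, abs_mul, abs_of_nonneg (Real.sqrt_nonneg _),
    show F ω ^ 3 = F ω * (F ω * F ω) by ring, abs_mul]
  gcongr
  exact abs_le_sqrt_one_add_sq _

theorem IsDivergence.integral_pow_three [IsFiniteMeasure P]
    (hX : ∀ φ, Measurable (X φ)) (hu : MemLp u 2 P) (hF : IsDivergence X P u F)
    (hDF : HasDeriv X P F DF) (hd : MemLp (fun ω => (inner ℝ (u ω) (DF ω) : ℝ)) 2 P) :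
    ∫ ω, F ω ^ 3 ∂P = 2 * ∫ ω, F ω * inner ℝ (u ω) (DF ω) ∂P := by
  have hFm := hF.1.1
  have h3 := hF.integrable_pow_three hX hu hDF hd
  have hFd : Integrable (fun ω => F ω * inner ℝ (u ω) (DF ω)) P := hF.1.integrable_mul hd
  have heq := fun n : ℕ => hF.integral_comp_mul_mul hX hu hDF hDF hd (a := n + 1)
    (contDiff_sinTrunc n) (hasDerivAt_sinTrunc n) (abs_sinTrunc_le n)
    (fun x => (Real.abs_cos_le_one _).trans (by linarith [(Nat.cast_nonneg n : (0 : ℝ) ≤ n)]))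
  have hTm : ∀ n, AEStronglyMeasurable (fun ω => sinTrunc n (F ω)) P := fun n =>
    (contDiff_sinTrunc n).continuous.comp_aestronglyMeasurable hFm
  have hcm : ∀ n : ℕ, AEStronglyMeasurable (fun ω => Real.cos (F ω / (n + 1))) P := fun n =>
    (by fun_prop : Continuous fun x : ℝ => Real.cos (x / (n + 1))).comp_aestronglyMeasurable hFm
  have l1 : Tendsto (fun n => ∫ ω, sinTrunc n (F ω) * (F ω * F ω) ∂P) atTop
      (𝓝 (∫ ω, F ω ^ 3 ∂P)) := by
    refine tendsto_integral_of_dominated_convergence (fun ω => |F ω ^ 3|)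
      (fun n => (hTm n).mul (hFm.mul hFm)) h3.abs
      (fun n => ae_of_all _ fun ω => ?_) (ae_of_all _ fun ω => ?_)
    · rw [Real.norm_eq_abs, pow_succ', pow_two]
      exact abs_mul_le_abs_mul (abs_sinTrunc_le_abs _ _) _
    · rw [pow_succ', pow_two]
      exact (tendsto_sinTrunc _).mul_const _
  have l2 : Tendsto (fun n : ℕ => ∫ ω, (Real.cos (F ω / (n + 1)) * (F ω * inner ℝ (u ω) (DF ω))
        + sinTrunc n (F ω) * inner ℝ (u ω) (DF ω)) ∂P) atTop
      (𝓝 (∫ ω, (F ω * inner ℝ (u ω) (DF ω) + F ω * inner ℝ (u ω) (DF ω)) ∂P)) := by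
    refine tendsto_integral_of_dominated_convergence
      (fun ω => |F ω * inner ℝ (u ω) (DF ω)| + |F ω * inner ℝ (u ω) (DF ω)|)
      (fun n => ((hcm n).mul hFd.1).add ((hTm n).mul hd.1)) (hFd.abs.add hFd.abs)
      (fun n => ae_of_all _ fun ω => ?_) (ae_of_all _ fun ω => ?_)
    · rw [Real.norm_eq_abs]
      refine (abs_add_le _ _).trans (add_le_add ?_ ?_)
      · rw [abs_mul]
        exact mul_le_of_le_one_left (abs_nonneg _) (Real.abs_cos_le_one _)
      · exact abs_mul_le_abs_mul (abs_sinTrunc_le_abs _ _) _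
    · refine Tendsto.add ?_ ((tendsto_sinTrunc _).mul_const _)
      simpa using (tendsto_cos_div (F ω)).mul_const (F ω * inner ℝ (u ω) (DF ω))
  rw [tendsto_nhds_unique l1 (by simpa only [heq] using l2), integral_add hFd hFd, two_mul]

end

/-! ### The total variation bound -/

/-- Stein's equation for the centering `h - E h(Z)` of a smooth bounded function, with the bounds on
the solution. -/
theorem exists_stein_solution {h : ℝ → ℝ} {c : ℝ}
    (hs : ContDiff ℝ ((⊤ : ℕ∞) : WithTop ℕ∞) h)
    (hc : ∀ x, |h x - ∫ y, h y ∂gaussianReal 0 1| ≤ c) :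
    ∃ f f' : ℝ → ℝ, ContDiff ℝ ((⊤ : ℕ∞) : WithTop ℕ∞) f ∧
      ContDiff ℝ ((⊤ : ℕ∞) : WithTop ℕ∞) f' ∧ (∀ x, HasDerivAt f (f' x) x) ∧
      (∀ x, f' x = x * f x + (h x - ∫ y, h y ∂gaussianReal 0 1)) ∧
      (∀ x, |f x| ≤ c * √(Real.pi / 2)) ∧ ∀ x, |f' x| ≤ 2 * c := by
  set m := ∫ y, h y ∂gaussianReal 0 1 with hm
  set k : ℝ → ℝ := fun x => h x - m with hk
  have hks : ContDiff ℝ ((⊤ : ℕ∞) : WithTop ℕ∞) k := hs.sub contDiff_const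
  have hi : Integrable h (gaussianReal 0 1) := by
    have := (integrable_of_continuous_of_abs_le (ν := gaussianReal 0 1) hks.continuous hc).add
      (integrable_const m)
    refine this.congr (ae_of_all _ fun x => ?_)
    simp [hk]
  have h0 : ∫ x, k x ∂gaussianReal 0 1 = 0 := by
    rw [hk, integral_sub hi (integrable_const _)]
    simp [hm]
  have hd := hasDerivAt_steinSol hks.continuous hc
  have hfs := contDiff_steinSol hks hc
  refine ⟨steinSol k, fun x => x * steinSol k x + k x, hfs, (contDiff_id.mul hfs).add hks, hd,
    fun x => rfl, abs_steinSol_le hks.continuous hc h0, fun x => ?_⟩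
  have := (hd x).deriv
  simp only [← this]
  exact abs_deriv_steinSol_le hks.continuous hc h0 x

theorem abs_sub_integral_le_of_abs_le {μ : Measure ℝ} [IsProbabilityMeasure μ] {h : ℝ → ℝ}
    {c : ℝ} (hc : ∀ x, |h x| ≤ c) (x : ℝ) : |h x - ∫ y, h y ∂μ| ≤ 2 * c := by
  have h1 := norm_integral_le_of_norm_le_const (μ := μ) (f := h) (ae_of_all _ hc)
  simp only [probReal_univ, mul_one, Real.norm_eq_abs] at h1
  have := abs_sub (h x) (∫ y, h y ∂μ)
  linarith [hc x]

section

variable {Ω H : Type*} [MeasurableSpace Ω] [NormedAddCommGroup H] [InnerProductSpace ℝ H]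
  {X : H → Ω → ℝ} {P : Measure Ω} {u : Ω → H} {F M : Ω → ℝ} {DF DM : Ω → H}

/-- For `φ' = x φ + h - E h(Z)`, `E[h(F)] - E h(Z) = E[φ'(F)] - E[φ'(F) D_u F]`. -/
theorem IsDivergence.integral_stein [IsFiniteMeasure P]
    (hX : ∀ φ, Measurable (X φ)) (hF : IsDivergence X P u F)
    (hDF : HasDeriv X P F DF) {h φ φ' : ℝ → ℝ} {a b m : ℝ}
    (hφs : ContDiff ℝ ((⊤ : ℕ∞) : WithTop ℕ∞) φ) (hφ's : ContDiff ℝ ((⊤ : ℕ∞) : WithTop ℕ∞) φ')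
    (hφ : ∀ x, HasDerivAt φ (φ' x) x) (hst : ∀ x, φ' x = x * φ x + (h x - m))
    (ha : ∀ x, |φ x| ≤ a) (hb : ∀ x, |φ' x| ≤ b) :
    ∫ ω, (h (F ω) - m) ∂P
      = ∫ ω, φ' (F ω) ∂P - ∫ ω, φ' (F ω) * inner ℝ (u ω) (DF ω) ∂P := by
  have i1 : Integrable (fun ω => φ (F ω) * F ω) P :=
    (hF.1.integrable one_le_two).bdd_mul (hφs.continuous.comp_aestronglyMeasurable hF.1.1)
      (ae_of_all _ fun ω => ha _)
  have i2 : Integrable (fun ω => φ' (F ω)) P :=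
    .of_bound (hφ's.continuous.comp_aestronglyMeasurable hF.1.1) b (ae_of_all _ fun ω => hb _)
  rw [← hF.integral_comp_mul hX hDF hφs hφ hb, ← integral_sub i2 i1]
  refine integral_congr_ae (ae_of_all _ fun ω => ?_)
  simp only [hst (F ω)]
  ring

/-- Stein's equation combined with integration by parts: for `φ' = x φ + h - E h(Z)`,
`E[(h(F) - E h(Z)) M] = -E[φ'(F) M (D_u F - 1)] - E[φ(F) D_u M]`. -/
theorem IsDivergence.integral_stein_mul [IsFiniteMeasure P]
    (hX : ∀ φ, Measurable (X φ)) (hu : MemLp u 2 P) (hF : IsDivergence X P u F)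
    (hDF : HasDeriv X P F DF) (hDM : HasDeriv X P M DM)
    (hd : MemLp (fun ω => (inner ℝ (u ω) (DF ω) : ℝ)) 2 P) {h φ φ' : ℝ → ℝ} {a m : ℝ}
    (hφs : ContDiff ℝ ((⊤ : ℕ∞) : WithTop ℕ∞) φ) (hφ's : ContDiff ℝ ((⊤ : ℕ∞) : WithTop ℕ∞) φ')
    (hφ : ∀ x, HasDerivAt φ (φ' x) x) (hst : ∀ x, φ' x = x * φ x + (h x - m))
    (ha : ∀ x, |φ x| ≤ a) (ha' : ∀ x, |φ' x| ≤ a) :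
    ∫ ω, (h (F ω) - m) * M ω ∂P
      = -(∫ ω, φ' (F ω) * (M ω * (inner ℝ (u ω) (DF ω) - 1)) ∂P)
        - ∫ ω, φ (F ω) * inner ℝ (u ω) (DM ω) ∂P := by
  have key := hF.integral_comp_mul_mul hX hu hDF hDM hd hφs hφ ha ha'
  have hφm : AEStronglyMeasurable (fun ω => φ (F ω)) P :=
    hφs.continuous.comp_aestronglyMeasurable hF.1.1
  have hφ'm : AEStronglyMeasurable (fun ω => φ' (F ω)) P :=
    hφ's.continuous.comp_aestronglyMeasurable hF.1.1
  have i1 : Integrable (fun ω => φ (F ω) * (M ω * F ω)) P :=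
    (hDM.1.integrable_mul hF.1).bdd_mul hφm (ae_of_all _ fun ω => ha _)
  have i2 : Integrable (fun ω => φ' (F ω) * (M ω * inner ℝ (u ω) (DF ω))) P :=
    (hDM.1.integrable_mul hd).bdd_mul hφ'm (ae_of_all _ fun ω => ha' _)
  have i3 : Integrable (fun ω => φ (F ω) * inner ℝ (u ω) (DM ω)) P :=
    (integrable_inner_of_memLp hu hDM.2.1).bdd_mul hφm (ae_of_all _ fun ω => ha _)
  have i4 : Integrable (fun ω => φ' (F ω) * M ω) P :=
    (hDM.1.integrable one_le_two).bdd_mul hφ'm (ae_of_all _ fun ω => ha' _)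
  rw [integral_add i2 i3] at key
  have e1 : ∫ ω, (h (F ω) - m) * M ω ∂P
      = ∫ ω, (φ' (F ω) * M ω - φ (F ω) * (M ω * F ω)) ∂P := by
    refine integral_congr_ae (ae_of_all _ fun ω => ?_)
    have := hst (F ω)
    simp only [this]
    ring
  have e2 : ∫ ω, φ' (F ω) * (M ω * (inner ℝ (u ω) (DF ω) - 1)) ∂P
      = ∫ ω, (φ' (F ω) * (M ω * inner ℝ (u ω) (DF ω)) - φ' (F ω) * M ω) ∂P := by
    refine integral_congr_ae (ae_of_all _ fun ω => ?_)
    simp only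
    ring
  rw [e1, e2, integral_sub i4 i1, integral_sub i2 i4, key]
  ring

theorem abs_integral_mul_le {f g : Ω → ℝ} {C : ℝ} (hg : Integrable g P)
    (hf : ∀ ω, |f ω| ≤ C) : |∫ ω, f ω * g ω ∂P| ≤ C * ∫ ω, |g ω| ∂P := by
  rw [← integral_const_mul]
  refine abs_integral_le_integral_abs.trans (integral_mono_of_nonneg
    (ae_of_all _ fun ω => abs_nonneg _) (hg.abs.const_mul C) (ae_of_all _ fun ω => ?_))
  simp only [abs_mul]
  exact mul_le_mul_of_nonneg_right (hf ω) (abs_nonneg _)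

/-- The bound on a smooth test function `h` with values in `[0, 1]`; here `d`, `e` and `DE` stand for
`D_u F`, `D_u² F` and `D(D_u² F)`. Stein's equation is solved three times: for `h`, for the
derivative of the first solution, and for the second solution itself. -/
theorem IsDivergence.abs_integral_sub_le [IsProbabilityMeasure P]
    (hX : ∀ φ, Measurable (X φ)) (hu : MemLp u 2 P) (hF : IsDivergence X P u F)
    {d e : Ω → ℝ} {DD DE : Ω → H}
    (hDF : HasDeriv X P F DF) (hDD : HasDeriv X P d DD) (hDE : HasDeriv X P e DE)
    (hd : ∀ ω, d ω = inner ℝ (u ω) (DF ω)) (he : ∀ ω, e ω = inner ℝ (u ω) (DD ω))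
    (hF2 : ∫ ω, F ω ^ 2 ∂P = 1) {h : ℝ → ℝ} (hs : ContDiff ℝ ((⊤ : ℕ∞) : WithTop ℕ∞) h)
    (h01 : ∀ x, h x ∈ Set.Icc 0 1) :
    |∫ ω, h (F ω) ∂P - ∫ x, h x ∂gaussianReal 0 1|
      ≤ (8 + √(32 * Real.pi)) * ∫ ω, (d ω - 1) ^ 2 ∂P
      + √(2 * Real.pi) * |∫ ω, F ω ^ 3 ∂P| + √(32 * Real.pi) * ∫ ω, |e ω| ^ 2 ∂P
      + 4 * Real.pi * ∫ ω, |(inner ℝ (u ω) (DE ω) : ℝ)| ∂P := by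
  have hdf : d = fun ω => inner ℝ (u ω) (DF ω) := funext hd
  have hef : e = fun ω => inner ℝ (u ω) (DD ω) := funext he
  have hd2 : MemLp (fun ω => (inner ℝ (u ω) (DF ω) : ℝ)) 2 P := hdf ▸ hDD.1
  have hdi : Integrable d P := hDD.1.integrable one_le_two
  have hei : Integrable e P := hDE.1.integrable one_le_two
  have hd1 : MemLp (fun ω => d ω - 1) 2 P := hDD.1.sub (memLp_const 1)
  have hdsq : Integrable (fun ω => (d ω - 1) ^ 2) P := hd1.integrable_sq
  have hesq : Integrable (fun ω => e ω ^ 2) P := hDE.1.integrable_sq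
  -- the first moments of `D_u F` and `D_u² F`
  have hEd : ∫ ω, d ω ∂P = 1 := by
    have := hF.2 _ _ hDF
    simp only [← pow_two, hF2] at this
    rw [this, hdf]
    simp only [real_inner_comm]
  have hEe : ∫ ω, e ω ∂P = 2⁻¹ * ∫ ω, F ω ^ 3 ∂P := by
    have h1 := hF.2 _ _ hDD
    rw [hF.integral_pow_three hX hu hDF hd2, hef]
    simp only [← hd, real_inner_comm (u _)] at h1 ⊢
    simp only [mul_comm (F _), h1]
    ring
  -- all constants are expressed through `r = √(π/2)`, the sup bound in Stein's equation
  set r := √(Real.pi / 2) with hr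
  have hr0 : 0 ≤ r := Real.sqrt_nonneg _
  have hrr : r * r = Real.pi / 2 := Real.mul_self_sqrt (by positivity)
  have hr32 : √(32 * Real.pi) = 8 * r := by
    rw [show 32 * Real.pi = 8 ^ 2 * (Real.pi / 2) by ring, Real.sqrt_mul (by positivity),
      Real.sqrt_sq (by norm_num)]
  have hr2 : √(2 * Real.pi) = 2 * r := by
    rw [show 2 * Real.pi = 2 ^ 2 * (Real.pi / 2) by ring, Real.sqrt_mul (by positivity),
      Real.sqrt_sq (by norm_num)]
  have hhi : Integrable h (gaussianReal 0 1) :=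
    integrable_of_continuous_of_abs_le (C := 1) hs.continuous fun x => by
      rw [abs_le]
      constructor <;> linarith [(h01 x).1, (h01 x).2]
  have hhc : ∀ x, |h x - ∫ y, h y ∂gaussianReal 0 1| ≤ 1 := fun x => by
    have h1 : 0 ≤ ∫ y, h y ∂gaussianReal 0 1 := integral_nonneg fun y => (h01 y).1
    have h2 : ∫ y, h y ∂gaussianReal 0 1 ≤ 1 := by
      have := integral_mono hhi (integrable_const 1) fun y => (h01 y).2
      simpa using this
    rw [abs_le]
    constructor <;> linarith [(h01 x).1, (h01 x).2]
  obtain ⟨f, f', hfs, hf's, hf, hfe, hfb, hf'b⟩ := exists_stein_solution hs hhc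
  obtain ⟨φ, φ', hφs, hφ's, hφ, hφe, hφb, hφ'b⟩ := exists_stein_solution hf's
    (abs_sub_integral_le_of_abs_le hf'b)
  obtain ⟨ψ, ψ', hψs, hψ's, hψ, hψe, hψb, hψ'b⟩ := exists_stein_solution hφs
    (abs_sub_integral_le_of_abs_le hφb)
  set mf := ∫ y, f' y ∂gaussianReal 0 1
  set mφ := ∫ y, φ y ∂gaussianReal 0 1
  have hcomp : ∀ {g : ℝ → ℝ}, ContDiff ℝ ((⊤ : ℕ∞) : WithTop ℕ∞) g →
      AEStronglyMeasurable (fun ω => g (F ω)) P := fun hg =>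
    hg.continuous.comp_aestronglyMeasurable hF.1.1
  have ihF : Integrable (fun ω => h (F ω)) P :=
    .of_bound (hcomp hs) 1 (ae_of_all _ fun ω => by
      rw [Real.norm_eq_abs, abs_le]
      constructor <;> linarith [(h01 (F ω)).1, (h01 (F ω)).2])
  have if' : Integrable (fun ω => f' (F ω)) P :=
    .of_bound (hcomp hf's) _ (ae_of_all _ fun ω => hf'b _)
  have if'd : Integrable (fun ω => f' (F ω) * d ω) P :=
    hdi.bdd_mul (hcomp hf's) (ae_of_all _ fun ω => hf'b _)
  -- `f'` may be centered because `E[d - 1] = 0`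
  have s1 : ∫ ω, h (F ω) ∂P - ∫ x, h x ∂gaussianReal 0 1
      = -(∫ ω, (f' (F ω) - mf) * d ω ∂P - ∫ ω, (f' (F ω) - mf) ∂P) := by
    have h1 := hF.integral_stein hX hDF hfs hf's hf hfe hfb hf'b
    rw [integral_sub ihF (integrable_const _)] at h1
    simp only [← hd] at h1
    simp only [sub_mul]
    rw [integral_sub if'd (hdi.const_mul _), integral_sub if' (integrable_const _),
      integral_const_mul, hEd]
    simp only [integral_const, probReal_univ, one_smul] at h1 ⊢
    linarith
  -- as `E[d] = 1`, subtracting the case `M = 1` from `M = d` produces the square `(d - 1)²`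
  have hφB : ∀ x, |φ x| ≤ max (2 * (2 * 1) * r) (2 * (2 * (2 * 1))) := fun x =>
    (hφb x).trans (le_max_left _ _)
  have hφ'B : ∀ x, |φ' x| ≤ max (2 * (2 * 1) * r) (2 * (2 * (2 * 1))) := fun x =>
    (hφ'b x).trans (le_max_right _ _)
  have s2 : ∫ ω, (f' (F ω) - mf) * d ω ∂P - ∫ ω, (f' (F ω) - mf) ∂P
      = -(∫ ω, φ' (F ω) * (d ω - 1) ^ 2 ∂P) - ∫ ω, φ (F ω) * e ω ∂P := by
    have h1 := hF.integral_stein_mul hX hu hDF hDD hd2 hφs hφ's hφ hφe hφB hφ'B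
    have h2 := hF.integral_stein hX hDF hφs hφ's hφ hφe hφb hφ'b
    simp only [← hd, ← he] at h1 h2
    have h3 : ∫ ω, φ' (F ω) * (d ω - 1) ^ 2 ∂P = ∫ ω, φ' (F ω) * (d ω * (d ω - 1)) ∂P
        - (∫ ω, φ' (F ω) * d ω ∂P - ∫ ω, φ' (F ω) ∂P) := by
      have iφ'dd : Integrable (fun ω => φ' (F ω) * (d ω * (d ω - 1))) P :=
        (hDD.1.integrable_mul hd1).bdd_mul (hcomp hφ's) (ae_of_all _ fun ω => hφ'b _)
      have iφ'd : Integrable (fun ω => φ' (F ω) * d ω) P :=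
        hdi.bdd_mul (hcomp hφ's) (ae_of_all _ fun ω => hφ'b _)
      have iφ' : Integrable (fun ω => φ' (F ω)) P :=
        .of_bound (hcomp hφ's) _ (ae_of_all _ fun ω => hφ'b _)
      have iφ'' : Integrable (fun ω => φ' (F ω) * d ω - φ' (F ω)) P := iφ'd.sub iφ'
      rw [← integral_sub iφ'd iφ', ← integral_sub iφ'dd iφ'']
      refine integral_congr_ae (ae_of_all _ fun ω => ?_)
      simp only
      ring
    rw [h1, h2, h3]
    ring
  have s3 : ∫ ω, (φ (F ω) - mφ) * e ω ∂P
      = -(∫ ω, ψ' (F ω) * (e ω * (d ω - 1)) ∂P)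
        - ∫ ω, ψ (F ω) * inner ℝ (u ω) (DE ω) ∂P := by
    have := hF.integral_stein_mul hX hu hDF hDE hd2 hψs hψ's hψ hψe
      (fun x => (hψb x).trans (le_max_left _ _)) (fun x => (hψ'b x).trans (le_max_right _ _))
    simpa only [← hd] using this
  have s4 : ∫ ω, (φ (F ω) - mφ) * e ω ∂P
      = ∫ ω, φ (F ω) * e ω ∂P - mφ * ∫ ω, e ω ∂P := by
    simp only [sub_mul]
    rw [integral_sub (hei.bdd_mul (hcomp hφs) (ae_of_all _ fun ω => hφb _)) (hei.const_mul _),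
      integral_const_mul]
  have b1 : |∫ ω, φ' (F ω) * (d ω - 1) ^ 2 ∂P| ≤ 8 * ∫ ω, (d ω - 1) ^ 2 ∂P := by
    have := abs_integral_mul_le (f := fun ω => φ' (F ω)) hdsq fun ω => hφ'b _
    simp only [abs_pow, sq_abs] at this
    linarith
  have b2 : |∫ ω, ψ' (F ω) * (e ω * (d ω - 1)) ∂P|
      ≤ 8 * r * (∫ ω, e ω ^ 2 ∂P + ∫ ω, (d ω - 1) ^ 2 ∂P) := by
    have hed : Integrable (fun ω => e ω * (d ω - 1)) P := hDE.1.integrable_mul hd1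
    have h1 := abs_integral_mul_le (f := fun ω => ψ' (F ω)) hed fun ω => hψ'b _
    have h2 : 2 * ∫ ω, |e ω * (d ω - 1)| ∂P ≤ ∫ ω, e ω ^ 2 ∂P + ∫ ω, (d ω - 1) ^ 2 ∂P := by
      rw [← integral_const_mul, ← integral_add hesq hdsq]
      refine integral_mono (hed.abs.const_mul 2) (hesq.add hdsq) fun ω => ?_
      simp only [abs_mul]
      nlinarith [sq_nonneg (|e ω| - |d ω - 1|), sq_abs (e ω), sq_abs (d ω - 1)]
    calc _ ≤ _ := h1
      _ = 8 * r * (2 * ∫ ω, |e ω * (d ω - 1)| ∂P) := by ring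
      _ ≤ _ := by gcongr
  have b3 : |∫ ω, ψ (F ω) * inner ℝ (u ω) (DE ω) ∂P|
      ≤ 4 * Real.pi * ∫ ω, |(inner ℝ (u ω) (DE ω) : ℝ)| ∂P := by
    refine (abs_integral_mul_le (f := fun ω => ψ (F ω)) (integrable_inner_of_memLp hu hDE.2.1)
      fun ω => hψb _).trans (le_of_eq ?_)
    rw [← hr, show 2 * (2 * (2 * 1) * r) * r = 8 * (r * r) by ring, hrr]
    ring
  have b4 : |mφ * ∫ ω, e ω ∂P| ≤ 2 * r * |∫ ω, F ω ^ 3 ∂P| := by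
    have h1 : |mφ| ≤ 4 * r := by
      have := norm_integral_le_of_norm_le_const (μ := gaussianReal 0 1) (f := φ)
        (ae_of_all _ hφb)
      simp only [probReal_univ, mul_one, Real.norm_eq_abs] at this
      linarith
    rw [hEe, abs_mul, abs_mul, abs_of_pos (by norm_num : (0 : ℝ) < 2⁻¹)]
    calc _ ≤ 4 * r * (2⁻¹ * |∫ ω, F ω ^ 3 ∂P|) := by gcongr
      _ = _ := by ring
  have hfin : ∫ ω, h (F ω) ∂P - ∫ x, h x ∂gaussianReal 0 1
      = ∫ ω, φ' (F ω) * (d ω - 1) ^ 2 ∂P - ∫ ω, ψ' (F ω) * (e ω * (d ω - 1)) ∂P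
        - ∫ ω, ψ (F ω) * inner ℝ (u ω) (DE ω) ∂P + mφ * ∫ ω, e ω ∂P := by
    rw [s1, s2]
    linarith
  rw [hfin, hr32, hr2]
  simp only [sq_abs]
  rw [abs_le] at *
  constructor <;> nlinarith [b1.1, b1.2, b2.1, b2.2, b3.1, b3.2, b4.1, b4.2]

end

end Malliavin

theorem proposition3p2 {Ω H : Type*} [MeasurableSpace Ω] [NormedAddCommGroup H]
    [InnerProductSpace ℝ H] [CompleteSpace H] [TopologicalSpace.SeparableSpace H]
    (P : Measure Ω) [IsProbabilityMeasure P] (X : H → Ω → ℝ)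
    (hX : Malliavin.IsIsonormal X P) (hgen : Malliavin.Generates X P)
    (u : Ω → H) (F : Ω → ℝ)
    (hu : Malliavin.MemDomDelta X P u) (hF : Malliavin.IsDivergence X P u F)
    (hF32 : Malliavin.MemSobolev X P 3 2 F) (hF2 : ∫ ω, F ω ^ 2 ∂P = 1)
    (hDu1 : Malliavin.MemSobolev X P 1 2 (Malliavin.Du X P u F))
    (hDu2 : Malliavin.MemSobolev X P 1 2 ((Malliavin.Du X P u)^[2] F)) :
    Integrable (fun ω => F ω ^ 3) P ∧
    Malliavin.dTV (P.map F) (gaussianReal 0 1) ≤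
      (8 + √(32 * Real.pi)) * ∫ ω, ‖Malliavin.D X P (Malliavin.Du X P u F) ω‖ ^ 2 ∂P
      + √(2 * Real.pi) * |∫ ω, F ω ^ 3 ∂P|
      + √(32 * Real.pi) * ∫ ω, |(Malliavin.Du X P u)^[2] F ω| ^ 2 ∂P
      + 4 * Real.pi * ∫ ω, |(Malliavin.Du X P u)^[3] F ω| ∂P := by
  have hD : ∀ {A : Ω → ℝ}, Malliavin.MemSobolev X P 1 2 A →
      Malliavin.HasDeriv X P A (Malliavin.D X P A) := fun {A} hA => by
    have h := (Malliavin.memSobolev_one_two_iff hX.measurable).1 hA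
    rw [Malliavin.D, dif_pos h]
    exact h.choose_spec
  have hF12 : Malliavin.MemSobolev X P 1 2 F := by
    obtain ⟨h1, S, h2, h3⟩ := hF32
    exact ⟨h1, S, h2, fun i hi => h3 i (Finset.Icc_subset_Icc_right (by norm_num) hi)⟩
  have hDF := hD hF12
  have hDD := hD hDu1
  have hDE := hD hDu2
  have hdi : MemLp (fun ω => (inner ℝ (u ω) (Malliavin.D X P F ω) : ℝ)) 2 P := hDD.1
  refine ⟨hF.integrable_pow_three hX.measurable hu.1 hDF hdi, ?_⟩
  have hprob : IsProbabilityMeasure (P.map F) := Measure.isProbabilityMeasure_map hF.1.1.aemeasurable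
  refine Malliavin.dTV_le_of_forall_contDiff fun f hfs hf01 => ?_
  rw [integral_map hF.1.1.aemeasurable hfs.continuous.aestronglyMeasurable]
  -- `E (D_u F) = E F² = 1`, so the Poincaré inequality bounds the variance `E (D_u F - 1)²`
  have hmean : ∫ ω, Malliavin.Du X P u F ω ∂P = 1 := by
    have := hF.2 _ _ hDF
    simp only [← pow_two, hF2] at this
    rw [this]
    simp only [Malliavin.Du, real_inner_comm]
  have hpoin := hDD.poincare hX
  rw [hmean] at hpoin
  have hvar : ∫ ω, (Malliavin.Du X P u F ω - 1) ^ 2 ∂P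
      = ∫ ω, Malliavin.Du X P u F ω ^ 2 ∂P - 1 := by
    have i1 : Integrable (fun ω => Malliavin.Du X P u F ω ^ 2) P := hDD.1.integrable_sq
    have i2 : Integrable (fun ω => 2 * Malliavin.Du X P u F ω - 1) P :=
      ((hDD.1.integrable one_le_two).const_mul 2).sub (integrable_const 1)
    have e : ∀ ω, (Malliavin.Du X P u F ω - 1) ^ 2
        = Malliavin.Du X P u F ω ^ 2 - (2 * Malliavin.Du X P u F ω - 1) := fun ω => by ring
    simp only [e]
    rw [integral_sub i1 i2, integral_sub ((hDD.1.integrable one_le_two).const_mul 2)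
      (integrable_const 1), integral_const_mul, hmean]
    simp
    norm_num
  have hle : ∫ ω, (Malliavin.Du X P u F ω - 1) ^ 2 ∂P
      ≤ ∫ ω, ‖Malliavin.D X P (Malliavin.Du X P u F) ω‖ ^ 2 ∂P := by
    rw [hvar]
    linarith
  refine (hF.abs_integral_sub_le hX.measurable hu.1 hDF hDD hDE (fun _ => rfl) (fun _ => rfl) hF2
    hfs hf01).trans ?_
  exact add_le_add (add_le_add (add_le_add
    (mul_le_mul_of_nonneg_left hle (by positivity)) le_rfl) le_rfl) le_rfl
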